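/- Let $(M,g,\mathcal C)$ be a space-time of dimension $n\ge 2$: $M$ is a smooth $n$-manifold, $g$ a smooth Lorentzian metric of signature $(-,+,\dots,+)$, and $\mathcal C\subset TM$ is the closure of the set $\{v : g(v,v)<0,\ g(X,v)<0\}$ of future pointing time-like vectors determined by some continuous time-like vector field $X$. Let $\nabla$ be the Levi-Civita connection, $R(X,Y)Z=\nabla_X\nabla_YZ-\nabla_Y\nabla_XZ-\nabla_{[X,Y]}Z$, and $\mathrm{Ric}_x(v,w)=\sum_{i}g(e_i,e_i)\,g(R(e_i,w)v,e_i)$ for a $g$-orthonormal basis $(e_i)$ of $T_xM$. For a function $f$ let $\nabla_g f$ be its gradient, $g(\nabla_gf,Y)=df(Y)$, and let $\mathrm{Hess}_f(v)=\nabla_v\nabla_gf$, $\mathrm{Hess}_f(v,w)=g(\mathrm{Hess}_f(v),w)$, and $g(\mathrm{Hess}_f,\mathrm{Hess}_f)=\sum_{i,j}g(e_i,e_i)g(e_j,e_j)\mathrm{Hess}_f(e_i,e_j)^2$. Let $U\subset M$ be open, $q\in(-\infty,0)$, and let $\phi\in C^3(U)$ satisfy $-\nabla_g\phi\in\mathrm{Int}(\mathcal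 C)$ on $U$. Put $$\nabla^q_g\phi:=-|g(\nabla_g\phi,\nabla_g\phi)|^{\frac{q-2}{2}}\nabla_g\phi,\qquad \Box^q_g\phi:=\mathrm{div}(-\nabla^q_g\phi),$$ where $\mathrm{div}\,Y$ is the trace of $v\mapsto\nabla_vY$, and let $L^q_\phi$ be the linearization of the $q$-Box operator at $\phi$, $$L^q_\phi u:=\left.\frac{d}{dt}\right|_{t=0}\Box^q_g(\phi+tu).$$ Then $L^q_\phi u$ is well defined on $U$ (the derivative exists at every point of $U$) for every $u\in C^2(U)$, the function $\frac1q(-g(\nabla_g\phi,\nabla_g\phi))^{q/2}$ belongs to $C^2(U)$, $\Box^q_g\phi$ belongs to $C^1(U)$, and at every point of $U$ $$\begin{aligned} -L^{q}_{\phi}\left(\frac{(-g(\nabla_{g} \phi, \nabla_{g} \phi))^{q/2}}{q} \right)={}& g( \nabla_{g} \Box_{g}^{q} \phi,- \nabla_{g}^{q} \phi) + (q-2)^{2}\, |g(\nabla_{g} \phi, \nabla_{g} \phi)|^{q-2} \left( \frac{\mathrm{Hess}_{\phi}(\nabla_{g}\phi, \nabla_{g}\phi)}{|g(\nabla_{g}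 \phi, \nabla_{g} \phi)|} \right)^{2}\\ &+ |g(\nabla_{g} \phi, \nabla_{g} \phi)|^{q-2} \big( \mathrm{Ric} (\nabla_{g} \phi, \nabla_{g} \phi) + g(\mathrm{Hess}_{\phi}, \mathrm{Hess}_{\phi}) \big)\\ &- 2 (q-2) \, |g(\nabla_{g} \phi, \nabla_{g} \phi)|^{q-3}\, \mathrm{Hess}_{\phi}\left(\nabla_{g}\phi, \mathrm{Hess}_{\phi}(\nabla_{g}\phi)\right). \end{aligned}$$ -/

import Mathlib

open Set Filter Topology Bundle VectorField FiberBundle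
open scoped Manifold ContDiff

noncomputable section

/-- A Lorentzian metric on an `n`-dimensional smooth manifold `M`: a smooth symmetric `(0,2)`-tensor
field that has signature `(-,+,…,+)` at every point. -/
structure LorentzianMetric (n : ℕ) (M : Type*) [TopologicalSpace M]
    [ChartedSpace (EuclideanSpace ℝ (Fin n)) M] [IsManifold (𝓡 n) ∞ M] where
  /-- The bilinear form on each tangent space. -/
  inner (x : M) : TangentSpace (𝓡 n) x →L[ℝ] TangentSpace (𝓡 n) x →L[ℝ] ℝ
  symm (x : M) (v w : TangentSpace (𝓡 n) x) : inner x v w = inner x w v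
  exists_orthonormal (x : M) : ∃ b : Module.Basis (Fin n) ℝ (TangentSpace (𝓡 n) x),
    ∀ i j, inner x (b i) (b j) = if i = j then (if (i : ℕ) = 0 then -1 else 1) else 0
  contMDiff : ContMDiff (𝓡 n)
    ((𝓡 n).prod 𝓘(ℝ, EuclideanSpace ℝ (Fin n) →L[ℝ] EuclideanSpace ℝ (Fin n) →L[ℝ] ℝ)) ∞
    (fun x ↦ TotalSpace.mk' (EuclideanSpace ℝ (Fin n) →L[ℝ] EuclideanSpace ℝ (Fin n) →L[ℝ] ℝ)
      x (inner x))

namespace LorentzianMetric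

section Basics

variable {n : ℕ} {M : Type*} [TopologicalSpace M]
  [ChartedSpace (EuclideanSpace ℝ (Fin n)) M] [IsManifold (𝓡 n) ∞ M]

/-- A time orientation of `(M, g)`: the closure `𝒞 ⊆ TM` of the set of future pointing time-like
vectors with respect to some continuous time-like vector field `X`. -/
structure TimeOrientation (g : LorentzianMetric n M) where
  /-- The set of future pointing causal vectors (with the zero vectors). -/
  cone : Set (TangentBundle (𝓡 n) M)
  exists_field : ∃ X : (x : M) → TangentSpace (𝓡 n) x,
    Continuous (fun x ↦ (⟨x, X x⟩ : TangentBundle (𝓡 n) M)) ∧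
    (∀ x, g.inner x (X x) (X x) < 0) ∧
    cone = closure {v : TangentBundle (𝓡 n) M |
      g.inner v.proj v.snd v.snd < 0 ∧ g.inner v.proj (X v.proj) v.snd < 0}

variable (g : LorentzianMetric n M)

/-- A chosen `g`-orthonormal basis of `T_x M`. -/
def orthonormalBasis (x : M) : Module.Basis (Fin n) ℝ (TangentSpace (𝓡 n) x) :=
  (g.exists_orthonormal x).choose

theorem inner_orthonormalBasis (x : M) (i j : Fin n) :
    g.inner x (g.orthonormalBasis x i) (g.orthonormalBasis x j) =
      if i = j then (if (i : ℕ) = 0 then -1 else 1) else 0 :=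
  (g.exists_orthonormal x).choose_spec i j

theorem eq_zero_of_inner (x : M) (v : TangentSpace (𝓡 n) x) (h : ∀ w, g.inner x v w = 0) :
    v = 0 := by
  have hb := (g.orthonormalBasis x).sum_repr v
  have hz : ∀ i, (g.orthonormalBasis x).repr v i = 0 := by
    intro i
    have h1 := h (g.orthonormalBasis x i)
    rw [← hb] at h1
    simp only [map_sum, map_smul, _root_.sum_apply, _root_.smul_apply,
      inner_orthonormalBasis, smul_eq_mul, mul_ite, mul_zero, Finset.sum_ite_eq',
      Finset.mem_univ, if_true] at h1
    split_ifs at h1 <;> linarith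
  rw [← hb]
  simp [hz]

theorem inner_isInvertible (x : M) : (g.inner x).IsInvertible := by
  have hfd : FiniteDimensional ℝ (TangentSpace (𝓡 n) x) :=
    inferInstanceAs (FiniteDimensional ℝ (EuclideanSpace ℝ (Fin n)))
  have ht2 : T2Space (TangentSpace (𝓡 n) x) :=
    inferInstanceAs (T2Space (EuclideanSpace ℝ (Fin n)))
  let L : TangentSpace (𝓡 n) x →ₗ[ℝ] Module.Dual ℝ (TangentSpace (𝓡 n) x) :=
    (ContinuousLinearMap.coeLM ℝ).comp (g.inner x).toLinearMap
  have hL : Function.Injective L := by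
    refine (injective_iff_map_eq_zero L).2 fun v hv ↦ g.eq_zero_of_inner x v fun w ↦ ?_
    exact congrArg (fun l : Module.Dual ℝ (TangentSpace (𝓡 n) x) ↦ l w) hv
  let e : TangentSpace (𝓡 n) x ≃ₗ[ℝ] Module.Dual ℝ (TangentSpace (𝓡 n) x) :=
    LinearEquiv.ofInjectiveOfFinrankEq L hL Subspace.dual_finrank_eq.symm
  refine ContinuousLinearMap.IsInvertible.of_inverse
    (g := LinearMap.toContinuousLinearMap (e.symm.toLinearMap.comp (ContinuousLinearMap.coeLM ℝ)))
    ?_ ?_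
  · ext1 l
    have hl : L (e.symm (ContinuousLinearMap.coeLM ℝ l)) = ContinuousLinearMap.coeLM ℝ l :=
      e.apply_symm_apply _
    ext1 w
    exact congrArg (fun l : Module.Dual ℝ (TangentSpace (𝓡 n) x) ↦ l w) hl
  · ext1 v
    exact e.symm_apply_apply v

/-- The metric dual of a covector: the vector `♯ℓ` with `g(♯ℓ, w) = ℓ w` for all `w`. -/
def sharp (x : M) :
    (TangentSpace (𝓡 n) x →L[ℝ] ℝ) →L[ℝ] TangentSpace (𝓡 n) x :=
  (g.inner x).inverse

theorem inner_sharp (x : M) (l : TangentSpace (𝓡 n) x →L[ℝ] ℝ) (w : TangentSpace (𝓡 n) x) :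
    g.inner x (g.sharp x l) w = l w := by
  obtain ⟨e, he⟩ := g.inner_isInvertible x
  simp [sharp, ← he]

/-- Two vectors with the same `g`-products with all vectors are equal. -/
theorem ext_inner (x : M) {v v' : TangentSpace (𝓡 n) x}
    (h : ∀ w, g.inner x v w = g.inner x v' w) : v = v' :=
  sub_eq_zero.1 (g.eq_zero_of_inner x _ fun w ↦ by simp [h w])

/-- Differentiability at `x` of a vector field on `M`. -/
abbrev DiffAt (X : (x : M) → TangentSpace (𝓡 n) x) (x : M) : Prop :=
  MDifferentiableAt (𝓡 n) ((𝓡 n).prod 𝓘(ℝ, EuclideanSpace ℝ (Fin n)))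
    (fun y ↦ TotalSpace.mk' (EuclideanSpace ℝ (Fin n)) y (X y)) x

theorem mdifferentiableAt_inner {X Y : (x : M) → TangentSpace (𝓡 n) x} {x : M}
    (hX : DiffAt X x) (hY : DiffAt Y x) :
    MDifferentiableAt (𝓡 n) 𝓘(ℝ) (fun y ↦ g.inner y (X y) (Y y)) x := by
  have h := MDifferentiableAt.clm_bundle_apply₂ (F₁ := EuclideanSpace ℝ (Fin n))
    (F₂ := EuclideanSpace ℝ (Fin n)) (F₃ := ℝ) (E₃ := Bundle.Trivial M ℝ) (b := fun y : M ↦ y)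
    (ψ := fun y ↦ g.inner y) (g.contMDiff.contMDiffAt.mdifferentiableAt (by simp)) hX hY
  exact (by simpa [mdifferentiableAt_totalSpace] using h :
    MDifferentiableAt (𝓡 n) (𝓡 n) (fun y : M ↦ y) x ∧ _).2

/-- The Koszul expression: `g(∇_X Y, Z)` at `x` for the Levi-Civita connection `∇`. -/
def koszul (X Y Z : (x : M) → TangentSpace (𝓡 n) x) (x : M) : ℝ :=
  (mvfderiv (𝓡 n) (fun y ↦ g.inner y (Y y) (Z y)) x (X x)
    + mvfderiv (𝓡 n) (fun y ↦ g.inner y (X y) (Z y)) x (Y x)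
    - mvfderiv (𝓡 n) (fun y ↦ g.inner y (X y) (Y y)) x (Z x)
    + g.inner x (mlieBracket (𝓡 n) X Y x) (Z x)
    - g.inner x (mlieBracket (𝓡 n) X Z x) (Y x)
    - g.inner x (mlieBracket (𝓡 n) Y Z x) (X x)) / 2

theorem koszul_tensorial_right {X Y : (x : M) → TangentSpace (𝓡 n) x} {x : M}
    (hX : DiffAt X x) (hY : DiffAt Y x) :
    TensorialAt (𝓡 n) (EuclideanSpace ℝ (Fin n)) (fun Z ↦ g.koszul X Y Z x) x where
  smul hf hZ := by
    simp [koszul, mvfderiv_fun_mul hf (g.mdifferentiableAt_inner hY hZ),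
      mvfderiv_fun_mul hf (g.mdifferentiableAt_inner hX hZ), mlieBracket_smul_right hf hZ]
    rw [g.symm x _ (Y x), g.symm x _ (X x)]
    ring
  add hZ hZ' := by
    simp [koszul, mvfderiv_fun_add (g.mdifferentiableAt_inner hY hZ)
        (g.mdifferentiableAt_inner hY hZ'),
      mvfderiv_fun_add (g.mdifferentiableAt_inner hX hZ) (g.mdifferentiableAt_inner hX hZ'),
      mlieBracket_add_right hZ hZ']
    ring

theorem koszul_tensorial_left {Y Z : (x : M) → TangentSpace (𝓡 n) x} {x : M}
    (hY : DiffAt Y x) (hZ : DiffAt Z x) :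
    TensorialAt (𝓡 n) (EuclideanSpace ℝ (Fin n)) (fun X ↦ g.koszul X Y Z x) x where
  smul hf hX := by
    simp [koszul, mvfderiv_fun_mul hf (g.mdifferentiableAt_inner hX hY),
      mvfderiv_fun_mul hf (g.mdifferentiableAt_inner hX hZ), mlieBracket_smul_left hf hX]
    ring
  add hX hX' := by
    simp [koszul, mvfderiv_fun_add (g.mdifferentiableAt_inner hX hY)
        (g.mdifferentiableAt_inner hX' hY),
      mvfderiv_fun_add (g.mdifferentiableAt_inner hX hZ) (g.mdifferentiableAt_inner hX' hZ),
      mlieBracket_add_left hX hX']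
    ring

theorem koszul_add_mid {X Y Y' Z : (x : M) → TangentSpace (𝓡 n) x} {x : M}
    (hX : DiffAt X x) (hY : DiffAt Y x) (hY' : DiffAt Y' x) (hZ : DiffAt Z x) :
    g.koszul X (Y + Y') Z x = g.koszul X Y Z x + g.koszul X Y' Z x := by
  simp [koszul, mvfderiv_fun_add (g.mdifferentiableAt_inner hX hY)
      (g.mdifferentiableAt_inner hX hY'),
    mvfderiv_fun_add (g.mdifferentiableAt_inner hY hZ) (g.mdifferentiableAt_inner hY' hZ),
    mlieBracket_add_left hY hY', mlieBracket_add_right hY hY']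
  ring

theorem koszul_smul_mid {X Y Z : (x : M) → TangentSpace (𝓡 n) x} {f : M → ℝ} {x : M}
    (hX : DiffAt X x) (hY : DiffAt Y x) (hZ : DiffAt Z x)
    (hf : MDifferentiableAt (𝓡 n) 𝓘(ℝ) f x) :
    g.koszul X (f • Y) Z x =
      f x * g.koszul X Y Z x + mvfderiv (𝓡 n) f x (X x) * g.inner x (Y x) (Z x) := by
  simp [koszul, mvfderiv_fun_mul hf (g.mdifferentiableAt_inner hX hY),
    mvfderiv_fun_mul hf (g.mdifferentiableAt_inner hY hZ),
    mlieBracket_smul_left hf hY, mlieBracket_smul_right hf hY]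
  rw [g.symm x (Y x) (X x)]
  ring

open Classical in
/-- The covariant derivative `v ↦ (∇_v Y)(x)` of a vector field `Y` with respect to the Levi-Civita
connection, by the Koszul formula (and `0` if `Y` is not differentiable at `x`). -/
def nablaAux (Y : (x : M) → TangentSpace (𝓡 n) x) (x : M) :
    TangentSpace (𝓡 n) x →L[ℝ] TangentSpace (𝓡 n) x :=
  if hY : DiffAt Y x then
    (g.sharp x).comp (TensorialAt.mkHom₂ (I := 𝓡 n) (F := EuclideanSpace ℝ (Fin n))
      (F' := EuclideanSpace ℝ (Fin n)) (fun X Z ↦ g.koszul X Y Z x) x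
      (fun _ hZ ↦ g.koszul_tensorial_left hY hZ) (fun _ hX ↦ g.koszul_tensorial_right hX hY))
  else 0

theorem inner_nablaAux {X Y Z : (x : M) → TangentSpace (𝓡 n) x} {x : M}
    (hX : DiffAt X x) (hY : DiffAt Y x) (hZ : DiffAt Z x) :
    g.inner x (g.nablaAux Y x (X x)) (Z x) = g.koszul X Y Z x := by
  rw [nablaAux, dif_pos hY, ContinuousLinearMap.comp_apply, inner_sharp]
  exact TensorialAt.mkHom₂_apply _ _ hX hZ

/-- The Levi-Civita connection of `(M, g)`. -/
def leviCivita : CovariantDerivative (𝓡 n) (EuclideanSpace ℝ (Fin n))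
    (TangentSpace (𝓡 n) : M → Type _) where
  toFun := g.nablaAux
  isCovariantDerivativeOnUniv :=
    { add := by
        intro Y Y' x hY hY' _
        ext1 v
        refine g.ext_inner x fun w ↦ ?_
        have hv := mdifferentiableAt_extend (𝓡 n) (EuclideanSpace ℝ (Fin n)) v
        have hw := mdifferentiableAt_extend (𝓡 n) (EuclideanSpace ℝ (Fin n)) w
        have h := g.inner_nablaAux hv (mdifferentiableAt_add_section hY hY') hw
        have h1 := g.inner_nablaAux hv hY hw
        have h2 := g.inner_nablaAux hv hY' hw
        simp only [extend_apply_self] at h h1 h2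
        simp only [_root_.add_apply, map_add]
        rw [h, h1, h2, g.koszul_add_mid hv hY hY' hw]
      leibniz := by
        intro Y f x hY hf _
        ext1 v
        refine g.ext_inner x fun w ↦ ?_
        have hv := mdifferentiableAt_extend (𝓡 n) (EuclideanSpace ℝ (Fin n)) v
        have hw := mdifferentiableAt_extend (𝓡 n) (EuclideanSpace ℝ (Fin n)) w
        have h := g.inner_nablaAux hv (hf.smul_section hY) hw
        have h1 := g.inner_nablaAux hv hY hw
        rw [g.koszul_smul_mid hv hY hw hf] at h
        simp only [extend_apply_self] at h h1
        rw [h, ← h1]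
        simp }

theorem leviCivita_torsion : g.leviCivita.torsion = 0 := by
  rw [CovariantDerivative.torsion_eq_zero_iff]
  intro X Y x hX hY
  refine g.ext_inner x fun w ↦ ?_
  have hw := mdifferentiableAt_extend (𝓡 n) (EuclideanSpace ℝ (Fin n)) w
  have h1 := g.inner_nablaAux hX hY hw
  have h2 := g.inner_nablaAux hY hX hw
  simp only [koszul, extend_apply_self] at h1 h2
  rw [mlieBracket_swap_apply (V := Y) (W := X)] at h2
  simp only [g.symm _ (Y _) (X _), map_neg, _root_.neg_apply] at h2
  have h3 : g.inner x (g.leviCivita Y x (X x) - g.leviCivita X x (Y x)) w =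
      g.inner x (g.nablaAux Y x (X x)) w - g.inner x (g.nablaAux X x (Y x)) w := by
    simp [leviCivita]
  rw [h3, h1, h2]
  ring

theorem leviCivita_metric {Y Z : (x : M) → TangentSpace (𝓡 n) x} {x : M}
    (hY : DiffAt Y x) (hZ : DiffAt Z x) (v : TangentSpace (𝓡 n) x) :
    mvfderiv (𝓡 n) (fun y ↦ g.inner y (Y y) (Z y)) x v =
      g.inner x (g.leviCivita Y x v) (Z x) + g.inner x (Y x) (g.leviCivita Z x v) := by
  have hv := mdifferentiableAt_extend (𝓡 n) (EuclideanSpace ℝ (Fin n)) v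
  have h1 := g.inner_nablaAux hv hY hZ
  have h2 := g.inner_nablaAux hv hZ hY
  rw [koszul, mlieBracket_swap_apply (V := Z) (W := Y)] at h2
  rw [koszul] at h1
  simp only [extend_apply_self, g.symm _ (Z _) (Y _), map_neg, _root_.neg_apply] at h1 h2
  rw [g.symm x (Y x)]
  simp only [leviCivita]
  rw [h1, h2]
  ring

/-- The gradient `∇_g f`, defined by `g(∇_g f, w) = df(w)`. -/
def grad (f : M → ℝ) (x : M) : TangentSpace (𝓡 n) x :=
  g.sharp x (mvfderiv (𝓡 n) f x)

/-- The Hessian of `f` at `x` as an endomorphism of `T_x M`: `Hess_f(v) = ∇_v ∇_g f`. -/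
def hess (f : M → ℝ) (x : M) : TangentSpace (𝓡 n) x →L[ℝ] TangentSpace (𝓡 n) x :=
  g.leviCivita (g.grad f) x

/-- The Hessian of `f` at `x` as a bilinear form: `Hess_f(v, w) = g(∇_v ∇_g f, w)`. -/
def hessForm (f : M → ℝ) (x : M) (v w : TangentSpace (𝓡 n) x) : ℝ :=
  g.inner x (g.hess f x v) w

/-- `g(Hess_f, Hess_f)` at `x`: the square of the `(0,2)`-tensor `Hess_f` for the inner product that
`g` induces on tensors, computed in a `g`-orthonormal basis. -/
def hessSq (f : M → ℝ) (x : M) : ℝ :=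
  ∑ i, ∑ j,
    g.inner x (g.orthonormalBasis x i) (g.orthonormalBasis x i) *
    g.inner x (g.orthonormalBasis x j) (g.orthonormalBasis x j) *
    g.hessForm f x (g.orthonormalBasis x i) (g.orthonormalBasis x j) ^ 2

/-- The divergence of a vector field: `div Y = tr (v ↦ ∇_v Y)`. -/
def div (Y : (x : M) → TangentSpace (𝓡 n) x) (x : M) : ℝ :=
  LinearMap.trace ℝ (TangentSpace (𝓡 n) x) (g.leviCivita Y x).toLinearMap

/-- The Riemann curvature `R(X, Y)Z = ∇_X ∇_Y Z - ∇_Y ∇_X Z - ∇_[X,Y] Z` of vector fields. -/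
def riemann (X Y Z : (x : M) → TangentSpace (𝓡 n) x) (x : M) : TangentSpace (𝓡 n) x :=
  g.leviCivita (fun y ↦ g.leviCivita Z y (Y y)) x (X x)
    - g.leviCivita (fun y ↦ g.leviCivita Z y (X y)) x (Y x)
    - g.leviCivita Z x (mlieBracket (𝓡 n) X Y x)

/-- The curvature `R(u, v)w` of tangent vectors at `x`, by extending them to vector fields that are
smooth near `x`. -/
def riemannAt (x : M) (u v w : TangentSpace (𝓡 n) x) : TangentSpace (𝓡 n) x :=
  g.riemann (extend (EuclideanSpace ℝ (Fin n)) u) (extend (EuclideanSpace ℝ (Fin n)) v)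
    (extend (EuclideanSpace ℝ (Fin n)) w) x

/-- The Ricci curvature `Ric_x(v, w) = ∑ i, g(e_i, e_i) g(R(e_i, w)v, e_i)`, where `(e_i)` is a
`g`-orthonormal basis of `T_x M`. -/
def ric (x : M) (v w : TangentSpace (𝓡 n) x) : ℝ :=
  ∑ i, g.inner x (g.orthonormalBasis x i) (g.orthonormalBasis x i) *
    g.inner x (g.riemannAt x (g.orthonormalBasis x i) w v) (g.orthonormalBasis x i)

/-- `g(∇_g f, ∇_g f)`. -/
def gradSq (f : M → ℝ) (x : M) : ℝ := g.inner x (g.grad f x) (g.grad f x)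

/-- The `q`-gradient `∇^q_g f = -|g(∇_g f, ∇_g f)|^((q-2)/2) ∇_g f`. -/
def qGrad (q : ℝ) (f : M → ℝ) (x : M) : TangentSpace (𝓡 n) x :=
  -(|g.gradSq f x| ^ ((q - 2) / 2) • g.grad f x)

/-- The `q`-Box operator `□^q_g f = div(-∇^q_g f)`. -/
def qBox (q : ℝ) (f : M → ℝ) (x : M) : ℝ :=
  g.div (fun y ↦ -g.qGrad q f y) x

/-- The linearization `L^q_φ u = d/dt|_{t=0} □^q_g(φ + t u)` of the `q`-Box operator at `φ`. -/
def qBoxLin (q : ℝ) (φ u : M → ℝ) (x : M) : ℝ :=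
  deriv (fun t : ℝ ↦ g.qBox q (fun y ↦ φ y + t * u y) x) 0

end Basics

end LorentzianMetric

end

/-!
Let `N = ∇ f`, let `w = -g(N, N)`, which is positive because a vector in the interior of the future
cone is time-like (`inner_self_neg_of_mem_interior`), and let `p = (q - 2) / 2`.

By the product rule `□^q f = w ^ p div N + p w ^ (p - 1) dw(N)` (`qBox_eq`). Each ingredient taken
for `f + t u` is, at a fixed point, a polynomial in `t`, so the linearization is an ordinary
derivative in one variable and can be written down (`hasDerivAt_qBox`).

Since the Hessian is symmetric (`inner_hess_comm`), `dw = -2 g(∇_N N, ·)`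
(`mvfderiv_neg_gradSq`), and hence `u = w ^ (q / 2) / q` has gradient `-w ^ p ∇_N N`
(`grad_rpow_neg_gradSq`). The only second derivatives of `u` in `L^q u` are `div (∇ u)`, which
contains `div (∇_N N)`, and the derivative of `g(N, ∇ u)` along `N`. The former is given by
Bochner's identity

  `div (∇_N N) = tr (∇N ∘ ∇N) + d(div N)(N) + Ric(N, N)`

(`div_leviCivita_self`), in which `tr (∇N ∘ ∇N) = g(Hess f, Hess f)` (`trace_hess_comp_hess`). The
derivatives of `div N` and of `g(∇_N N, N)` along `N` also occur in `d(□^q f)(N)`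
(`mvfderiv_qBox`), and they match; what is left is an identity of rational functions in `w`.

Bochner's identity is computed in the frame `(e_i)` of coordinate vector fields of a chart: it
is the trace of `∇_{e_i} ∇_N N = R(e_i, N)N + ∇_N ∇_{e_i} N + ∇_{[e_i, N]} N`, where the last two
terms contribute `d(div N)(N) + tr (∇N ∘ ∇N)` because the connection is torsion free and
the trace commutes with covariant derivatives (`mvfderiv_div`). As `f` is only of class `C³`, the
field `N` is only of class `C²`, and the curvature has to be seen to be tensorial on fields of that
regularity (`riemann_eq_riemannAt`). Regularity of `∇ f`, `∇_X Y` and `div Y` comes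
from `smoothAt_of_inner_frame`: a field is as regular as its `g`-products with the frame, and for
`∇_{e_i} Y` these are given by the Koszul formula.
-/

noncomputable section

namespace LorentzianMetric

/-! ### Derivatives and Lie brackets in a chart -/

theorem natCast_le_infty (k : ℕ) : (k : ℕ∞ω) ≤ ∞ := by exact_mod_cast le_top

theorem natCast_add_one_le_infty (k : ℕ) : (k : ℕ∞ω) + 1 ≤ ∞ := natCast_le_infty (k + 1)

section Chart

variable {n : ℕ} {M : Type*} [TopologicalSpace M] [ChartedSpace (EuclideanSpace ℝ (Fin n)) M]

/-- In the preferred chart at `x`, the derivative of `f` is the ordinary derivative. -/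
theorem mvfderiv_eq_fderiv {f : M → ℝ} {x : M} (hf : MDifferentiableAt (𝓡 n) 𝓘(ℝ) f x)
    (v : TangentSpace (𝓡 n) x) :
    mvfderiv (𝓡 n) f x v =
      fderiv ℝ (f ∘ (extChartAt (𝓡 n) x).symm) (extChartAt (𝓡 n) x x) v := by
  rw [hf.mvfderiv]
  have h : writtenInExtChartAt (𝓡 n) 𝓘(ℝ) x f = f ∘ (extChartAt (𝓡 n) x).symm := rfl
  rw [h, ModelWithCorners.range_eq_univ, fderivWithin_univ]
  rfl

end Chart

section Regularity

variable {n : ℕ} {M : Type*} [TopologicalSpace M]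
  [ChartedSpace (EuclideanSpace ℝ (Fin n)) M] [IsManifold (𝓡 n) ∞ M]

/-- `X` is of class `C^k` at `x`, as a section of the tangent bundle. -/
abbrev SmoothAt (k : ℕ∞ω) (X : (x : M) → TangentSpace (𝓡 n) x) (x : M) : Prop :=
  ContMDiffAt (𝓡 n) ((𝓡 n).prod 𝓘(ℝ, EuclideanSpace ℝ (Fin n))) k
    (fun y ↦ TotalSpace.mk' (EuclideanSpace ℝ (Fin n)) y (X y)) x

theorem contMDiffAt_inner (g : LorentzianMetric n M) {k : ℕ∞ω} (hk : k ≤ ∞)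
    {X Y : (x : M) → TangentSpace (𝓡 n) x} {x : M} (hX : SmoothAt k X x) (hY : SmoothAt k Y x) :
    ContMDiffAt (𝓡 n) 𝓘(ℝ) k (fun y ↦ g.inner y (X y) (Y y)) x := by
  have h := ContMDiffAt.clm_bundle_apply₂ (F₁ := EuclideanSpace ℝ (Fin n))
    (F₂ := EuclideanSpace ℝ (Fin n)) (F₃ := ℝ) (E₃ := Bundle.Trivial M ℝ) (b := fun y : M ↦ y)
    (ψ := fun y ↦ g.inner y) (g.contMDiff.contMDiffAt.of_le hk) hX hY
  simp only [contMDiffAt_totalSpace] at h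
  exact h.2

/-- One derivative is lost in `f ↦ df(X)`, and none of the regularity of `X`. -/
theorem contMDiffAt_mvfderiv_apply {k : ℕ} {f : M → ℝ}
    {X : (x : M) → TangentSpace (𝓡 n) x} {x : M}
    (hf : ContMDiffAt (𝓡 n) 𝓘(ℝ) ((k + 1 : ℕ) : ℕ∞ω) f x) (hX : SmoothAt k X x) :
    ContMDiffAt (𝓡 n) 𝓘(ℝ) k (fun y ↦ mvfderiv (𝓡 n) f y (X y)) x := by
  have h1 := hf.mfderiv_const (m := k) (by norm_cast)
  have h2 : ContMDiffAt (𝓡 n) 𝓘(ℝ).tangent k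
      (fun y ↦ (TotalSpace.mk' ℝ (f y) (mfderiv (𝓡 n) 𝓘(ℝ) f y (X y)) :
        TangentBundle 𝓘(ℝ) ℝ)) x :=
    ContMDiffAt.clm_apply_of_inCoordinates (F₁ := EuclideanSpace ℝ (Fin n)) (F₂ := ℝ)
      (E₁ := (TangentSpace (𝓡 n) : M → Type _)) (E₂ := (TangentSpace 𝓘(ℝ) : ℝ → Type _))
      (b₁ := id) (b₂ := f) h1 hX (hf.of_le (by norm_cast; omega))
  exact (contMDiff_snd_tangentBundle_modelSpace ℝ 𝓘(ℝ)).contMDiffAt.comp x h2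

/-- The vector field `V` read in the preferred chart at `x`, as a field on the model space: its
pullback by the inverse of the chart. The values are meaningful on the target of the chart only. -/
def chartField (V : (x : M) → TangentSpace (𝓡 n) x) (x : M) :
    EuclideanSpace ℝ (Fin n) → EuclideanSpace ℝ (Fin n) :=
  mpullbackWithin 𝓘(ℝ, EuclideanSpace ℝ (Fin n)) (𝓡 n) (extChartAt (𝓡 n) x).symm V (range (𝓡 n))

/-- The derivation `f ↦ V f` read in the preferred chart at `x`. -/
theorem mvfderiv_apply_comp_chart {f : M → ℝ} {x : M} (V : (x : M) → TangentSpace (𝓡 n) x)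
    (hf : ContMDiffAt (𝓡 n) 𝓘(ℝ) 1 f x) :
    ((fun y ↦ mvfderiv (𝓡 n) f y (V y)) ∘ (extChartAt (𝓡 n) x).symm) =ᶠ[𝓝 (extChartAt (𝓡 n) x x)]
      fun z ↦ fderiv ℝ (f ∘ (extChartAt (𝓡 n) x).symm) z (chartField V x z) := by
  have h1 : ∀ᶠ y in 𝓝 x, MDifferentiableAt (𝓡 n) 𝓘(ℝ) f y :=
    (contMDiffAt_iff_contMDiffAt_nhds (by simp) |>.1 hf).mono fun y hy ↦
      hy.mdifferentiableAt (by simp)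
  have h2 := (continuousAt_extChartAt_symm (I := 𝓡 n) x).tendsto
  rw [extChartAt_to_inv] at h2
  filter_upwards [h2.eventually h1, extChartAt_target_mem_nhds (I := 𝓡 n) x] with z hz hzt
  have h3 := isInvertible_mfderivWithin_extChartAt_symm (I := 𝓡 n) hzt
  have h4 : MDifferentiableAt 𝓘(ℝ, EuclideanSpace ℝ (Fin n)) (𝓡 n) (extChartAt (𝓡 n) x).symm z := by
    have h := mdifferentiableWithinAt_extChartAt_symm (I := 𝓡 n) hzt
    rwa [ModelWithCorners.range_eq_univ, mdifferentiableWithinAt_univ] at h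
  have h5 := mvfderiv_comp_apply (I := 𝓘(ℝ, EuclideanSpace ℝ (Fin n))) z hz h4
    (mpullbackWithin 𝓘(ℝ, EuclideanSpace ℝ (Fin n)) (𝓡 n) (extChartAt (𝓡 n) x).symm V
      (range (𝓡 n)) z)
  rw [← mfderivWithin_univ, ← ModelWithCorners.range_eq_univ (𝓡 n), mpullbackWithin_apply] at h5
  have h6 : (mfderivWithin 𝓘(ℝ, EuclideanSpace ℝ (Fin n)) (𝓡 n) (extChartAt (𝓡 n) x).symm
      (range (𝓡 n)) z) ((mfderivWithin 𝓘(ℝ, EuclideanSpace ℝ (Fin n)) (𝓡 n)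
      (extChartAt (𝓡 n) x).symm (range (𝓡 n)) z).inverse (V ((extChartAt (𝓡 n) x).symm z))) =
      V ((extChartAt (𝓡 n) x).symm z) := by
    obtain ⟨e, he⟩ := h3
    rw [← he, ContinuousLinearMap.inverse_equiv]
    exact e.apply_symm_apply _
  rw [h6] at h5
  refine h5.symm.trans ?_
  rw [mvfderiv, mfderiv_eq_fderiv]
  rfl

/-- At the base point the chart is the identification of `T_x M` with the model space, so that `V`
and its chart representative have the same value there. -/
theorem chartField_self (V : (x : M) → TangentSpace (𝓡 n) x) (x : M) :
    chartField V x (extChartAt (𝓡 n) x x) = V x := by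
  have h : (V ((extChartAt (𝓡 n) x).symm (extChartAt (𝓡 n) x x)) : EuclideanSpace ℝ (Fin n)) =
      V x := congrArg (fun y ↦ (V y : EuclideanSpace ℝ (Fin n))) (extChartAt_to_inv (I := 𝓡 n) x)
  exact (congrArg (fun v : EuclideanSpace ℝ (Fin n) ↦ (mfderivWithin 𝓘(ℝ, EuclideanSpace ℝ (Fin n))
    (𝓡 n) (extChartAt (𝓡 n) x).symm (range (𝓡 n)) (extChartAt (𝓡 n) x x)).inverse v) h).trans
    (mfderivWithin_extChartAt_symm_inverse_apply (I := 𝓡 n) (V x))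

theorem differentiableAt_chartField {V : (x : M) → TangentSpace (𝓡 n) x} {x : M}
    (hV : DiffAt V x) : DifferentiableAt ℝ (chartField V x) (extChartAt (𝓡 n) x x) := by
  have h : DifferentiableWithinAt ℝ (chartField V x)
      ((extChartAt (𝓡 n) x).symm ⁻¹' univ ∩ range (𝓡 n)) (extChartAt (𝓡 n) x x) :=
    (mdifferentiableWithinAt_univ.2 hV).differentiableWithinAt_mpullbackWithin_vectorField
  rwa [ModelWithCorners.range_eq_univ, preimage_univ, univ_inter, differentiableWithinAt_univ] at h

theorem mlieBracket_eq_lieBracket (X Y : (x : M) → TangentSpace (𝓡 n) x) (x : M) :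
    mlieBracket (𝓡 n) X Y x =
      lieBracket ℝ (chartField X x) (chartField Y x) (extChartAt (𝓡 n) x x) := by
  have h1 : lieBracketWithin ℝ (chartField X x) (chartField Y x)
      ((extChartAt (𝓡 n) x).symm ⁻¹' univ ∩ range (𝓡 n)) (extChartAt (𝓡 n) x x) =
      lieBracket ℝ (chartField X x) (chartField Y x) (extChartAt (𝓡 n) x x) := by
    rw [ModelWithCorners.range_eq_univ, preimage_univ, univ_inter, lieBracketWithin_univ]
  have h2 : (mfderiv (𝓡 n) 𝓘(ℝ, EuclideanSpace ℝ (Fin n)) (extChartAt (𝓡 n) x) x :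
      EuclideanSpace ℝ (Fin n) →L[ℝ] EuclideanSpace ℝ (Fin n)).inverse =
      ContinuousLinearMap.id ℝ _ :=
    (congrArg (fun A : EuclideanSpace ℝ (Fin n) →L[ℝ] EuclideanSpace ℝ (Fin n) ↦ A.inverse)
      (mfderiv_extChartAt_self (I := 𝓡 n))).trans ContinuousLinearMap.inverse_id
  exact (congrArg (fun A : EuclideanSpace ℝ (Fin n) →L[ℝ] EuclideanSpace ℝ (Fin n) ↦ A _)
    h2).trans h1

/-- `[X, Y] f = X (Y f) - Y (X f)` for the Lie bracket of vector fields. -/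
theorem mvfderiv_mlieBracket_apply {f : M → ℝ}
    {X Y : (x : M) → TangentSpace (𝓡 n) x} {x : M}
    (hf : ContMDiffAt (𝓡 n) 𝓘(ℝ) 2 f x) (hX : DiffAt X x) (hY : DiffAt Y x)
    (hfX : MDifferentiableAt (𝓡 n) 𝓘(ℝ) (fun y ↦ mvfderiv (𝓡 n) f y (X y)) x)
    (hfY : MDifferentiableAt (𝓡 n) 𝓘(ℝ) (fun y ↦ mvfderiv (𝓡 n) f y (Y y)) x) :
    mvfderiv (𝓡 n) f x (mlieBracket (𝓡 n) X Y x) =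
      mvfderiv (𝓡 n) (fun y ↦ mvfderiv (𝓡 n) f y (Y y)) x (X x) -
      mvfderiv (𝓡 n) (fun y ↦ mvfderiv (𝓡 n) f y (X y)) x (Y x) := by
  have hf1 : ContMDiffAt (𝓡 n) 𝓘(ℝ) 1 f x := hf.of_le (by norm_num)
  have hc : ContDiffAt ℝ 2 (f ∘ (extChartAt (𝓡 n) x).symm) (extChartAt (𝓡 n) x x) := by
    have := (contMDiffAt_iff.1 hf).2
    rw [ModelWithCorners.range_eq_univ] at this
    exact this
  have key := fderiv_apply_lieBracket hc (by simp) (differentiableAt_chartField hY)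
    (differentiableAt_chartField hX)
  rw [mvfderiv_eq_fderiv hfX, mvfderiv_eq_fderiv hfY,
    (mvfderiv_apply_comp_chart X hf1).fderiv_eq, (mvfderiv_apply_comp_chart Y hf1).fderiv_eq,
    mvfderiv_eq_fderiv (hf1.mdifferentiableAt (by simp)), mlieBracket_eq_lieBracket]
  rw [chartField_self, chartField_self] at key
  exact key

end Regularity

/-! ### Coordinate frames and regularity of vector fields -/

section Determinant

variable {n : ℕ} {M : Type*} [TopologicalSpace M] [ChartedSpace (EuclideanSpace ℝ (Fin n)) M]

theorem contMDiffAt_det {k : ℕ∞ω} {x : M} {A : M → Matrix (Fin n) (Fin n) ℝ}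
    (hA : ∀ i j, ContMDiffAt (𝓡 n) 𝓘(ℝ) k (fun y ↦ A y i j) x) :
    ContMDiffAt (𝓡 n) 𝓘(ℝ) k (fun y ↦ (A y).det) x := by
  simp only [Matrix.det_apply']
  exact contMDiffAt_finsetSum fun σ _ ↦ contMDiffAt_const.mul
    (contMDiffAt_finsetProd fun i _ ↦ hA _ _)

end Determinant

section Frames

variable {n : ℕ} {M : Type*} [TopologicalSpace M]
  [ChartedSpace (EuclideanSpace ℝ (Fin n)) M] [IsManifold (𝓡 n) ∞ M]

theorem eventually_smoothAt {k : ℕ} {X : (x : M) → TangentSpace (𝓡 n) x} {x : M}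
    (hX : SmoothAt k X x) : ∀ᶠ y in 𝓝 x, SmoothAt k X y := by
  have : IsManifold (𝓡 n) ((k : ℕ∞ω) + 1) M := IsManifold.of_le (natCast_add_one_le_infty k)
  have : IsManifold (𝓡 n) (k : ℕ∞ω) M := IsManifold.of_le (natCast_le_infty k)
  exact (contMDiffAt_iff_contMDiffAt_nhds (by simp)).1 hX

theorem eventually_contMDiffAt {k : ℕ} {f : M → ℝ} {x : M} (hf : ContMDiffAt (𝓡 n) 𝓘(ℝ) k f x) :
    ∀ᶠ y in 𝓝 x, ContMDiffAt (𝓡 n) 𝓘(ℝ) k f y := by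
  have : IsManifold (𝓡 n) (k : ℕ∞ω) M := IsManifold.of_le (natCast_le_infty k)
  exact (contMDiffAt_iff_contMDiffAt_nhds (by simp)).1 hf

theorem SmoothAt.diffAt {k : ℕ} {X : (x : M) → TangentSpace (𝓡 n) x} {x : M}
    (hX : SmoothAt k X x) (hk : k ≠ 0) : DiffAt X x :=
  ContMDiffAt.mdifferentiableAt hX (by simpa using hk)

/-- The domain of the preferred chart at `x`, as the base set of the trivialization of the tangent
bundle there. -/
abbrev coordNhd (x : M) : Set M :=
  (trivializationAt (EuclideanSpace ℝ (Fin n)) (TangentSpace (𝓡 n)) x).baseSet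

/-- The frame of coordinate vector fields of the preferred chart at `x` (`0` outside its domain). -/
def frame (x : M) (i : Fin n) (y : M) : TangentSpace (𝓡 n) y :=
  (trivializationAt (EuclideanSpace ℝ (Fin n)) (TangentSpace (𝓡 n)) x).localFrame
    (EuclideanSpace.basisFun (Fin n) ℝ).toBasis i y

/-- The coefficients of a vector in the frame of coordinate vector fields of the preferred chart at
`x`, that is, the coframe dual to `frame x` (`0` outside the domain of the chart). -/
def coframe (x : M) (i : Fin n) (y : M) : TangentSpace (𝓡 n) y →ₗ[ℝ] ℝ :=
  (trivializationAt (EuclideanSpace ℝ (Fin n)) (TangentSpace (𝓡 n)) x).localFrameCoeff (𝓡 n)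
    (EuclideanSpace.basisFun (Fin n) ℝ).toBasis i y

/-- The basis of `T_y M` formed by the coordinate vector fields of the chart at `x`. -/
def frameBasis (x : M) {y : M}
    (hy : y ∈ coordNhd (n := n) x) :
    Module.Basis (Fin n) ℝ (TangentSpace (𝓡 n) y) :=
  (trivializationAt (EuclideanSpace ℝ (Fin n)) (TangentSpace (𝓡 n)) x).basisAt
    (EuclideanSpace.basisFun (Fin n) ℝ).toBasis hy

theorem frameBasis_apply {x y : M} (hy : y ∈ coordNhd (n := n) x)
    (i : Fin n) : frameBasis x hy i = frame x i y := by
  exact ((trivializationAt (EuclideanSpace ℝ (Fin n))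
    (TangentSpace (𝓡 n)) x).localFrame_apply_of_mem_baseSet
    (EuclideanSpace.basisFun (Fin n) ℝ).toBasis hy).symm

theorem frameBasis_repr {x y : M} (hy : y ∈ coordNhd (n := n) x)
    (v : TangentSpace (𝓡 n) y) (i : Fin n) : (frameBasis x hy).repr v i = coframe x i y v := by
  have := (trivializationAt (EuclideanSpace ℝ (Fin n))
    (TangentSpace (𝓡 n)) x).localFrameCoeff_apply_of_mem_baseSet (I := 𝓡 n)
    (EuclideanSpace.basisFun (Fin n) ℝ).toBasis hy (extend (EuclideanSpace ℝ (Fin n)) v) i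
  rw [extend_apply_self] at this
  exact this.symm

theorem eventually_mem_baseSet (x : M) : ∀ᶠ y in 𝓝 x, y ∈ coordNhd (n := n) x :=
  (trivializationAt (EuclideanSpace ℝ (Fin n)) (TangentSpace (𝓡 n)) x).open_baseSet.mem_nhds
    (FiberBundle.mem_baseSet_trivializationAt' x)

theorem sum_coframe_smul_frame {x y : M} (hy : y ∈ coordNhd (n := n) x)
    (v : TangentSpace (𝓡 n) y) : ∑ i, coframe x i y v • frame x i y = v := by
  simpa [frameBasis_apply, frameBasis_repr] using (frameBasis x hy).sum_repr v

theorem trace_eq_sum_coframe {x y : M} (hy : y ∈ coordNhd (n := n) x)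
    (A : TangentSpace (𝓡 n) y →ₗ[ℝ] TangentSpace (𝓡 n) y) :
    LinearMap.trace ℝ _ A = ∑ i, coframe x i y (A (frame x i y)) := by
  rw [LinearMap.trace_eq_matrix_trace ℝ (frameBasis x hy)]
  simp [Matrix.trace, LinearMap.toMatrix_apply, frameBasis_apply, frameBasis_repr]

theorem smoothAt_frame {x y : M} (hy : y ∈ coordNhd (n := n) x)
    (i : Fin n) : SmoothAt ∞ (frame x i) y :=
  contMDiffAt_localFrame_of_mem ∞ _ _ i hy

theorem contMDiffAt_coframe {k : ℕ} {x y : M} (hy : y ∈ coordNhd (n := n) x)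
    (i : Fin n) {V : (x : M) → TangentSpace (𝓡 n) x} (hV : SmoothAt k V y) :
    ContMDiffAt (𝓡 n) 𝓘(ℝ) k (fun z ↦ coframe x i z (V z)) y := by
  have : IsManifold (𝓡 n) ((k : ℕ∞ω) + 1) M := IsManifold.of_le (natCast_add_one_le_infty k)
  exact contMDiffAt_localFrameCoeff _ hy hV i

theorem smoothAt_of_coframe {k : ℕ} {x y : M} (hy : y ∈ coordNhd (n := n) x)
    {V : (x : M) → TangentSpace (𝓡 n) x}
    (h : ∀ i, ContMDiffAt (𝓡 n) 𝓘(ℝ) k (fun z ↦ coframe x i z (V z)) y) : SmoothAt k V y := by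
  have : IsManifold (𝓡 n) ((k : ℕ∞ω) + 1) M := IsManifold.of_le (natCast_add_one_le_infty k)
  exact (contMDiffAt_iff_localFrameCoeff _ hy).2 h

/-- A vector field is as regular as its `g`-products with the coordinate frame: by Cramer's rule its
coefficients are rational functions of these products and of the entries of the Gram matrix. -/
theorem smoothAt_of_inner_frame (g : LorentzianMetric n M) {k : ℕ} {x : M}
    {V : (x : M) → TangentSpace (𝓡 n) x}
    (h : ∀ j, ContMDiffAt (𝓡 n) 𝓘(ℝ) k (fun z ↦ g.inner z (V z) (frame x j z)) x) :
    SmoothAt k V x := by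
  have hx := (eventually_mem_baseSet (n := n) x).self_of_nhds
  refine smoothAt_of_coframe hx fun i ↦ ?_
  -- the Gram matrix of the frame, invertible at `x` since `g` is nondegenerate
  let G : M → Matrix (Fin n) (Fin n) ℝ := fun y ↦
    Matrix.of fun j l ↦ g.inner y (frame x j y) (frame x l y)
  have hG : ∀ j l, ContMDiffAt (𝓡 n) 𝓘(ℝ) k (fun y ↦ G y j l) x := fun j l ↦
    (g.contMDiffAt_inner le_rfl (smoothAt_frame hx j) (smoothAt_frame hx l)).of_le
      (natCast_le_infty k)
  have hGa : ∀ y, y ∈ coordNhd (n := n) x →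
      ∀ v : TangentSpace (𝓡 n) y, (G y).mulVec (fun j ↦ coframe x j y v) =
        fun j ↦ g.inner y v (frame x j y) := by
    intro y hy v
    ext j
    conv_rhs => rw [← sum_coframe_smul_frame hy v]
    simp [Matrix.mulVec, dotProduct, G, g.symm y (frame x j y), mul_comm]
  have hdet : (G x).det ≠ 0 := by
    intro h0
    obtain ⟨c, hc, hc0⟩ := Matrix.exists_mulVec_eq_zero_iff.2 h0
    apply hc
    have hv := g.eq_zero_of_inner x (∑ i, c i • frame x i x) ?_
    · have := (frameBasis x hx).linearIndependent
      rw [Fintype.linearIndependent_iff] at this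
      ext i
      exact this c (by simpa [frameBasis_apply] using hv) i
    · intro w
      rw [← sum_coframe_smul_frame hx w]
      simp only [map_sum, map_smul, _root_.sum_apply, _root_.smul_apply]
      refine Finset.sum_eq_zero fun j _ ↦ ?_
      have := congrFun hc0 j
      simp [Matrix.mulVec, dotProduct, G, g.symm x (frame x j x), mul_comm] at this
      simp [this]
  -- Cramer's rule for the linear system `hGa`
  have hcr : ∀ᶠ y in 𝓝 x, coframe x i y (V y) =
      ((G y).updateCol i (fun j ↦ g.inner y (V y) (frame x j y))).det * (G y).det⁻¹ := by
    have hne := (contMDiffAt_det hG).continuousAt.eventually_ne hdet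
    filter_upwards [eventually_mem_baseSet (n := n) x, hne] with y hy hy0
    rw [← hGa y hy, ← Matrix.cramer_apply, Matrix.cramer_eq_adjugate_mulVec, Matrix.mulVec_mulVec,
      Matrix.adjugate_mul]
    simp [Matrix.smul_mulVec]
    field_simp
  refine ContMDiffAt.congr_of_eventuallyEq ?_ hcr
  refine (contMDiffAt_det fun j l ↦ ?_).mul ((contMDiffAt_det hG).inv₀ hdet)
  by_cases hl : l = i
  · subst hl; simpa using h j
  · simpa [Matrix.updateCol_apply, hl] using hG j l

end Frames

/-! ### Regularity and product rules for the connection, the gradient and the divergence -/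

section Connection

variable {n : ℕ} {M : Type*} [TopologicalSpace M]
  [ChartedSpace (EuclideanSpace ℝ (Fin n)) M] [IsManifold (𝓡 n) ∞ M] (g : LorentzianMetric n M)

theorem inner_grad (f : M → ℝ) (x : M) (v : TangentSpace (𝓡 n) x) :
    g.inner x (g.grad f x) v = mvfderiv (𝓡 n) f x v := g.inner_sharp _ _ _

theorem smoothAt_grad {k : ℕ} {f : M → ℝ} {x : M}
    (hf : ContMDiffAt (𝓡 n) 𝓘(ℝ) ((k + 1 : ℕ) : ℕ∞ω) f x) : SmoothAt k (g.grad f) x := by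
  refine g.smoothAt_of_inner_frame fun j ↦ ?_
  simp only [inner_grad]
  exact contMDiffAt_mvfderiv_apply hf
    ((smoothAt_frame (eventually_mem_baseSet (n := n) x).self_of_nhds j).of_le (natCast_le_infty _))

theorem contMDiffAt_koszul {k : ℕ} {X Y Z : (x : M) → TangentSpace (𝓡 n) x} {x : M}
    (hX : SmoothAt (k + 1 : ℕ) X x) (hY : SmoothAt (k + 1 : ℕ) Y x)
    (hZ : SmoothAt (k + 1 : ℕ) Z x) :
    ContMDiffAt (𝓡 n) 𝓘(ℝ) k (g.koszul X Y Z) x := by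
  have hk : ((k : ℕ) : ℕ∞ω) ≤ ((k + 1 : ℕ) : ℕ∞ω) := by norm_cast; omega
  have hk' : ((k + 1 : ℕ) : ℕ∞ω) ≤ ∞ := by exact_mod_cast le_top
  have hb : ∀ {V W : (x : M) → TangentSpace (𝓡 n) x}, SmoothAt (k + 1 : ℕ) V x →
      SmoothAt (k + 1 : ℕ) W x → SmoothAt k (mlieBracket (𝓡 n) V W) x := by
    intro V W hV hW
    have : IsManifold (𝓡 n) ((((k + 1 : ℕ) : ℕ∞) : ℕ∞ω) + 1) M :=
      IsManifold.of_le (natCast_add_one_le_infty (k + 1))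
    have : IsManifold (𝓡 n) (minSmoothness ℝ 2) M := by
      rw [minSmoothness_of_isRCLikeNormedField]
      infer_instance
    exact ContMDiffAt.mlieBracket_vectorField (m := (k : ℕ∞)) (n := ((k + 1 : ℕ) : ℕ∞)) hV hW
      (by simp)
  have hd : ∀ {U V W : (x : M) → TangentSpace (𝓡 n) x}, SmoothAt (k + 1 : ℕ) U x →
      SmoothAt (k + 1 : ℕ) V x → SmoothAt (k + 1 : ℕ) W x → ContMDiffAt (𝓡 n) 𝓘(ℝ) k
      (fun y ↦ mvfderiv (𝓡 n) (fun y ↦ g.inner y (V y) (W y)) y (U y)) x :=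
    fun hU hV hW ↦ contMDiffAt_mvfderiv_apply (g.contMDiffAt_inner hk' hV hW) (hU.of_le hk)
  have hi : ∀ {U V W : (x : M) → TangentSpace (𝓡 n) x}, SmoothAt (k + 1 : ℕ) U x →
      SmoothAt (k + 1 : ℕ) V x → SmoothAt (k + 1 : ℕ) W x → ContMDiffAt (𝓡 n) 𝓘(ℝ) k
      (fun y ↦ g.inner y (mlieBracket (𝓡 n) U V y) (W y)) x :=
    fun hU hV hW ↦ g.contMDiffAt_inner (hk.trans hk') (hb hU hV) (hW.of_le hk)
  exact ((((((hd hX hY hZ).add (hd hY hX hZ)).sub (hd hZ hX hY)).add (hi hX hY hZ)).sub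
    (hi hX hZ hY)).sub (hi hY hZ hX)).div_const 2

/-- The products of `∇_{e_i} Y` with the frame are given by the Koszul formula. -/
theorem smoothAt_leviCivita_frame {k : ℕ} {Y : (x : M) → TangentSpace (𝓡 n) x} {x : M}
    (hY : SmoothAt (k + 1 : ℕ) Y x) (i : Fin n) :
    SmoothAt k (fun y ↦ g.leviCivita Y y (frame x i y)) x := by
  refine g.smoothAt_of_inner_frame fun j ↦ ?_
  have hf : ∀ i, SmoothAt (k + 1 : ℕ) (frame x i) x := fun i ↦
    (smoothAt_frame (eventually_mem_baseSet (n := n) x).self_of_nhds i).of_le (natCast_le_infty _)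
  refine (g.contMDiffAt_koszul (hf i) hY (hf j)).congr_of_eventuallyEq ?_
  filter_upwards [eventually_smoothAt hY, eventually_smoothAt (hf i),
    eventually_smoothAt (hf j)] with y h1 h2 h3
  exact g.inner_nablaAux (h2.diffAt (by simp)) (h1.diffAt (by simp)) (h3.diffAt (by simp))

theorem smoothAt_leviCivita {k : ℕ} {X Y : (x : M) → TangentSpace (𝓡 n) x} {x : M}
    (hX : SmoothAt k X x) (hY : SmoothAt (k + 1 : ℕ) Y x) :
    SmoothAt k (fun y ↦ g.leviCivita Y y (X y)) x := by
  have hx := (eventually_mem_baseSet (n := n) x).self_of_nhds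
  have h : SmoothAt k
      (fun y ↦ ∑ i, coframe x i y (X y) • g.leviCivita Y y (frame x i y)) x := by
    refine ContMDiffAt.sum_section fun i _ ↦ ?_
    exact (contMDiffAt_coframe hx i hX).smul_section (g.smoothAt_leviCivita_frame hY i)
  refine h.congr_of_eventuallyEq ?_
  filter_upwards [eventually_mem_baseSet (n := n) x] with y hy
  congr 1
  conv_lhs => rw [← sum_coframe_smul_frame hy (X y)]
  simp

theorem contMDiffAt_div {k : ℕ} {Y : (x : M) → TangentSpace (𝓡 n) x} {x : M}
    (hY : SmoothAt (k + 1 : ℕ) Y x) : ContMDiffAt (𝓡 n) 𝓘(ℝ) k (g.div Y) x := by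
  have hx := (eventually_mem_baseSet (n := n) x).self_of_nhds
  have h : ContMDiffAt (𝓡 n) 𝓘(ℝ) k
      (fun y ↦ ∑ i, coframe x i y (g.leviCivita Y y (frame x i y))) x :=
    contMDiffAt_finsetSum fun i _ ↦ contMDiffAt_coframe hx i (g.smoothAt_leviCivita_frame hY i)
  refine h.congr_of_eventuallyEq ?_
  filter_upwards [eventually_mem_baseSet (n := n) x] with y hy
  exact trace_eq_sum_coframe hy _

theorem leviCivita_congr {Y Y' : (x : M) → TangentSpace (𝓡 n) x} {x : M} (hY' : DiffAt Y' x)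
    (h : ∀ᶠ y in 𝓝 x, Y y = Y' y) : g.leviCivita Y x = g.leviCivita Y' x := by
  have hY : DiffAt Y x := hY'.congr_of_eventuallyEq (h.mono fun y hy ↦ by simp [hy])
  exact g.leviCivita.isCovariantDerivativeOnUniv.congr_of_eventuallyEq hY hY' univ_mem h

theorem leviCivita_add {Y Y' : (x : M) → TangentSpace (𝓡 n) x} {x : M} (hY : DiffAt Y x)
    (hY' : DiffAt Y' x) (v : TangentSpace (𝓡 n) x) :
    g.leviCivita (fun y ↦ Y y + Y' y) x v = g.leviCivita Y x v + g.leviCivita Y' x v := by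
  have := g.leviCivita.isCovariantDerivativeOnUniv.add hY hY'
  exact congrArg (fun A ↦ A v) this

theorem leviCivita_smul {f : M → ℝ} {Y : (x : M) → TangentSpace (𝓡 n) x} {x : M}
    (hf : MDifferentiableAt (𝓡 n) 𝓘(ℝ) f x) (hY : DiffAt Y x) (v : TangentSpace (𝓡 n) x) :
    g.leviCivita (fun y ↦ f y • Y y) x v =
      f x • g.leviCivita Y x v + mvfderiv (𝓡 n) f x v • Y x := by
  have := g.leviCivita.isCovariantDerivativeOnUniv.leibniz hY hf
  exact congrArg (fun A ↦ A v) this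

theorem leviCivita_sum {ι : Type*} (s : Finset ι) {Y : ι → (x : M) → TangentSpace (𝓡 n) x} {x : M}
    (hY : ∀ i, DiffAt (Y i) x) (v : TangentSpace (𝓡 n) x) :
    g.leviCivita (fun y ↦ ∑ i ∈ s, Y i y) x v = ∑ i ∈ s, g.leviCivita (Y i) x v := by
  classical
  induction s using Finset.induction_on with
  | empty =>
    simp only [Finset.sum_empty]
    have := congrFun g.leviCivita.zero x
    exact congrArg (fun A ↦ A v) this
  | insert a s ha ih =>
    simp only [Finset.sum_insert ha]
    rw [← ih]
    exact g.leviCivita_add (hY a) (MDifferentiableAt.sum_section fun i _ ↦ hY i) v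

theorem div_congr {Y Y' : (x : M) → TangentSpace (𝓡 n) x} {x : M} (hY' : DiffAt Y' x)
    (h : ∀ᶠ y in 𝓝 x, Y y = Y' y) : g.div Y x = g.div Y' x := by
  rw [div, g.leviCivita_congr hY' h, div]

theorem div_add {Y Y' : (x : M) → TangentSpace (𝓡 n) x} {x : M} (hY : DiffAt Y x)
    (hY' : DiffAt Y' x) : g.div (fun y ↦ Y y + Y' y) x = g.div Y x + g.div Y' x := by
  rw [div, div, div, ← map_add]
  congr 1
  exact LinearMap.ext fun v ↦ g.leviCivita_add hY hY' v

theorem div_smul {f : M → ℝ} {Y : (x : M) → TangentSpace (𝓡 n) x} {x : M}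
    (hf : MDifferentiableAt (𝓡 n) 𝓘(ℝ) f x) (hY : DiffAt Y x) :
    g.div (fun y ↦ f y • Y y) x = f x * g.div Y x + mvfderiv (𝓡 n) f x (Y x) := by
  have h : (g.leviCivita (fun y ↦ f y • Y y) x).toLinearMap = f x • (g.leviCivita Y x).toLinearMap
      + (mvfderiv (𝓡 n) f x).toLinearMap.smulRight (Y x) :=
    LinearMap.ext fun v ↦ g.leviCivita_smul hf hY v
  have : Module.Finite ℝ (TangentSpace (𝓡 n) x) :=
    inferInstanceAs (Module.Finite ℝ (EuclideanSpace ℝ (Fin n)))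
  rw [div, h, map_add, map_smul, LinearMap.trace_smulRight]
  rfl

/-- The connection is torsion free. -/
theorem mlieBracket_eq {X Y : (x : M) → TangentSpace (𝓡 n) x} {x : M} (hX : DiffAt X x)
    (hY : DiffAt Y x) :
    mlieBracket (𝓡 n) X Y x = g.leviCivita Y x (X x) - g.leviCivita X x (Y x) :=
  ((CovariantDerivative.torsion_eq_zero_iff _).1 g.leviCivita_torsion hX hY).symm

/-- The Hessian is symmetric: its antisymmetric part is `d²f = 0` because the connection is torsion
free. -/
theorem inner_hess_comm {f : M → ℝ} {x : M} (hf : ContMDiffAt (𝓡 n) 𝓘(ℝ) 2 f x)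
    (v w : TangentSpace (𝓡 n) x) :
    g.inner x (g.hess f x v) w = g.inner x v (g.hess f x w) := by
  have hX := mdifferentiableAt_extend (𝓡 n) (EuclideanSpace ℝ (Fin n)) v
  have hY := mdifferentiableAt_extend (𝓡 n) (EuclideanSpace ℝ (Fin n)) w
  have hG : DiffAt (g.grad f) x := (g.smoothAt_grad (k := 1) hf).diffAt one_ne_zero
  have h1 := g.leviCivita_metric hG hX w
  have h2 := g.leviCivita_metric hG hY v
  have h3 := g.mdifferentiableAt_inner hG hX
  have h4 := g.mdifferentiableAt_inner hG hY
  simp only [inner_grad] at h1 h2 h3 h4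
  have h5 := mvfderiv_mlieBracket_apply hf hX hY h3 h4
  rw [g.mlieBracket_eq hX hY] at h5
  simp only [extend_apply_self, map_sub] at h1 h2 h5
  rw [h1, h2] at h5
  rw [g.symm x v, hess]
  linarith

end Connection

/-! ### Tensoriality of the curvature -/

section Curvature

variable {n : ℕ} {M : Type*} [TopologicalSpace M]
  [ChartedSpace (EuclideanSpace ℝ (Fin n)) M] [IsManifold (𝓡 n) ∞ M] (g : LorentzianMetric n M)

theorem mdifferentiableAt_coframe {x y : M} (hy : y ∈ coordNhd (n := n) x) (i : Fin n)
    {V : (x : M) → TangentSpace (𝓡 n) x} (hV : DiffAt V y) :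
    MDifferentiableAt (𝓡 n) 𝓘(ℝ) (fun z ↦ coframe x i z (V z)) y :=
  mdifferentiableAt_localFrameCoeff _ hy hV i

/-- Unlike `smoothAt_leviCivita`, this assumes differentiability of `X` at the single point `x`, as
`TensorialAt` requires. -/
theorem diffAt_leviCivita {X Y : (x : M) → TangentSpace (𝓡 n) x} {x : M} (hX : DiffAt X x)
    (hY : SmoothAt (2 : ℕ) Y x) : DiffAt (fun y ↦ g.leviCivita Y y (X y)) x := by
  have hx := (eventually_mem_baseSet (n := n) x).self_of_nhds
  have h : DiffAt (fun y ↦ ∑ i, coframe x i y (X y) • g.leviCivita Y y (frame x i y)) x :=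
    MDifferentiableAt.sum_section fun i _ ↦ (mdifferentiableAt_coframe hx i hX).smul_section
      (SmoothAt.diffAt (k := 1) (g.smoothAt_leviCivita_frame hY i) one_ne_zero)
  refine h.congr_of_eventuallyEq ?_
  filter_upwards [eventually_mem_baseSet (n := n) x] with y hy
  congr 1
  conv_lhs => rw [← sum_coframe_smul_frame hy (X y)]
  simp

theorem riemann_swap (X Y Z : (x : M) → TangentSpace (𝓡 n) x) (x : M) :
    g.riemann X Y Z x = -g.riemann Y X Z x := by
  rw [riemann, riemann, mlieBracket_swap_apply (V := X), map_neg]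
  abel

theorem riemann_tensorial_left {Y Z : (x : M) → TangentSpace (𝓡 n) x} {x : M}
    (hZ : SmoothAt (2 : ℕ) Z x) :
    TensorialAt (𝓡 n) (EuclideanSpace ℝ (Fin n)) (fun X ↦ g.riemann X Y Z x) x where
  smul {f X} hf hX := by
    have h := g.leviCivita_smul hf (g.diffAt_leviCivita hX hZ) (Y x)
    simp only [riemann, Pi.smul_apply', map_smul, mlieBracket_smul_left hf hX, map_add, map_neg,
      neg_smul]
    rw [h]
    module
  add {X X'} hX hX' := by
    have h := g.leviCivita_add (g.diffAt_leviCivita hX hZ) (g.diffAt_leviCivita hX' hZ) (Y x)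
    simp only [riemann, Pi.add_apply, mlieBracket_add_left hX hX', map_add]
    rw [h]
    abel

theorem riemann_add {X Y Z Z' : (x : M) → TangentSpace (𝓡 n) x} {x : M} (hX : DiffAt X x)
    (hY : DiffAt Y x) (hZ : SmoothAt (2 : ℕ) Z x) (hZ' : SmoothAt (2 : ℕ) Z' x) :
    g.riemann X Y (fun y ↦ Z y + Z' y) x = g.riemann X Y Z x + g.riemann X Y Z' x := by
  have h : ∀ {V : (x : M) → TangentSpace (𝓡 n) x}, DiffAt V x → ∀ v,
      g.leviCivita (fun y ↦ g.leviCivita (fun y ↦ Z y + Z' y) y (V y)) x v =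
      g.leviCivita (fun y ↦ g.leviCivita Z y (V y)) x v +
        g.leviCivita (fun y ↦ g.leviCivita Z' y (V y)) x v := by
    intro V hV v
    rw [← g.leviCivita_add (g.diffAt_leviCivita hV hZ) (g.diffAt_leviCivita hV hZ')]
    refine congrArg (fun A ↦ A v) (g.leviCivita_congr
      (mdifferentiableAt_add_section (g.diffAt_leviCivita hV hZ) (g.diffAt_leviCivita hV hZ')) ?_)
    filter_upwards [eventually_smoothAt hZ, eventually_smoothAt hZ'] with y h1 h2
    exact g.leviCivita_add (h1.diffAt two_ne_zero) (h2.diffAt two_ne_zero) _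
  simp only [riemann, h hX, h hY, g.leviCivita_add (hZ.diffAt two_ne_zero) (hZ'.diffAt two_ne_zero)]
  abel

/-- The second derivatives of `f` cancel since `[X, Y] f = X (Y f) - Y (X f)`. -/
theorem riemann_smul {X Y Z : (x : M) → TangentSpace (𝓡 n) x} {f : M → ℝ} {x : M}
    (hX : SmoothAt (1 : ℕ) X x) (hY : SmoothAt (1 : ℕ) Y x) (hZ : SmoothAt (2 : ℕ) Z x)
    (hf : ContMDiffAt (𝓡 n) 𝓘(ℝ) (2 : ℕ) f x) :
    g.riemann X Y (fun y ↦ f y • Z y) x = f x • g.riemann X Y Z x := by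
  have hfX := (contMDiffAt_mvfderiv_apply hf hX).mdifferentiableAt (by simp)
  have hfY := (contMDiffAt_mvfderiv_apply hf hY).mdifferentiableAt (by simp)
  have hf1 : MDifferentiableAt (𝓡 n) 𝓘(ℝ) f x := hf.mdifferentiableAt (by simp)
  have hZd := hZ.diffAt two_ne_zero
  have hf' : ∀ᶠ y in 𝓝 x, MDifferentiableAt (𝓡 n) 𝓘(ℝ) f y :=
    (eventually_contMDiffAt hf).mono fun y hy ↦ hy.mdifferentiableAt (by simp)
  have h : ∀ {V : (x : M) → TangentSpace (𝓡 n) x}, DiffAt V x →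
      MDifferentiableAt (𝓡 n) 𝓘(ℝ) (fun y ↦ mvfderiv (𝓡 n) f y (V y)) x → ∀ v,
      g.leviCivita (fun y ↦ g.leviCivita (fun y ↦ f y • Z y) y (V y)) x v =
      f x • g.leviCivita (fun y ↦ g.leviCivita Z y (V y)) x v +
        mvfderiv (𝓡 n) f x v • g.leviCivita Z x (V x) +
        (mvfderiv (𝓡 n) f x (V x) • g.leviCivita Z x v +
        mvfderiv (𝓡 n) (fun y ↦ mvfderiv (𝓡 n) f y (V y)) x v • Z x) := by
    intro V hV hfV v
    have hd := g.diffAt_leviCivita hV hZ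
    have h1 : DiffAt (fun y ↦ f y • g.leviCivita Z y (V y)) x := hf1.smul_section hd
    have h2 : DiffAt (fun y ↦ mvfderiv (𝓡 n) f y (V y) • Z y) x := hfV.smul_section hZd
    rw [← g.leviCivita_smul hf1 hd, ← g.leviCivita_smul hfV hZd, ← g.leviCivita_add h1 h2]
    refine congrArg (fun A ↦ A v) (g.leviCivita_congr (mdifferentiableAt_add_section h1 h2) ?_)
    filter_upwards [eventually_smoothAt hZ, hf'] with y h1 h2
    exact g.leviCivita_smul h2 (h1.diffAt two_ne_zero) _
  have hXd := hX.diffAt one_ne_zero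
  have hYd := hY.diffAt one_ne_zero
  simp only [riemann, h hXd hfX, h hYd hfY, g.leviCivita_smul hf1 hZd,
    mvfderiv_mlieBracket_apply hf hXd hYd hfX hfY]
  module

theorem riemann_sum {ι : Type*} (s : Finset ι) {X Y : (x : M) → TangentSpace (𝓡 n) x}
    {Z : ι → (x : M) → TangentSpace (𝓡 n) x} {x : M} (hX : DiffAt X x)
    (hY : DiffAt Y x) (hZ : ∀ i, SmoothAt (2 : ℕ) (Z i) x) :
    g.riemann X Y (fun y ↦ ∑ i ∈ s, Z i y) x = ∑ i ∈ s, g.riemann X Y (Z i) x := by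
  classical
  induction s using Finset.induction_on with
  | empty =>
    simp only [Finset.sum_empty, riemann]
    have h : ∀ y, g.leviCivita (fun y ↦ (0 : TangentSpace (𝓡 n) y)) y = 0 :=
      congrFun g.leviCivita.zero
    simp [h]
  | insert a s ha ih =>
    simp only [Finset.sum_insert ha]
    rw [← ih]
    exact g.riemann_add hX hY (hZ a) (ContMDiffAt.sum_section fun i _ ↦ hZ i)

theorem riemann_congr {X Y Z Z' : (x : M) → TangentSpace (𝓡 n) x} {x : M} (hX : DiffAt X x)
    (hY : DiffAt Y x) (hZ' : SmoothAt (2 : ℕ) Z' x) (h : ∀ᶠ y in 𝓝 x, Z y = Z' y) :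
    g.riemann X Y Z x = g.riemann X Y Z' x := by
  have h1 : ∀ᶠ y in 𝓝 x, g.leviCivita Z y = g.leviCivita Z' y := by
    filter_upwards [eventually_smoothAt hZ', h.eventually_nhds] with y h1 h2
    exact g.leviCivita_congr (h1.diffAt two_ne_zero) h2
  rw [riemann, riemann, h1.self_of_nhds,
    g.leviCivita_congr (g.diffAt_leviCivita hY hZ') (h1.mono fun y hy ↦ congrArg (· (Y y)) hy),
    g.leviCivita_congr (g.diffAt_leviCivita hX hZ') (h1.mono fun y hy ↦ congrArg (· (X y)) hy)]

/-- The value of `R(X, Y)Z` at `x` depends on `Z` through `Z x` only. Fields of class `C²` suffice,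
as the coefficients of `Z` in the frame are then of class `C²`. -/
theorem riemann_eq_sum {X Y Z : (x : M) → TangentSpace (𝓡 n) x} {x : M}
    (hX : SmoothAt (1 : ℕ) X x) (hY : SmoothAt (1 : ℕ) Y x) (hZ : SmoothAt (2 : ℕ) Z x) :
    g.riemann X Y Z x = ∑ i, coframe x i x (Z x) • g.riemann X Y (frame x i) x := by
  have hx := (eventually_mem_baseSet (n := n) x).self_of_nhds
  have hf : ∀ i, SmoothAt (2 : ℕ) (frame x i) x := fun i ↦
    (smoothAt_frame hx i).of_le (natCast_le_infty _)
  have hs : ∀ i, SmoothAt (2 : ℕ) (fun y ↦ coframe x i y (Z y) • frame x i y) x := fun i ↦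
    (contMDiffAt_coframe hx i hZ).smul_section (hf i)
  rw [g.riemann_congr (hX.diffAt one_ne_zero) (hY.diffAt one_ne_zero)
      (ContMDiffAt.sum_section fun i (_ : i ∈ Finset.univ) ↦ hs i)
      ((eventually_mem_baseSet x).mono fun y hy ↦ (sum_coframe_smul_frame hy (Z y)).symm),
    g.riemann_sum _ (hX.diffAt one_ne_zero) (hY.diffAt one_ne_zero) hs]
  exact Finset.sum_congr rfl fun i _ ↦ g.riemann_smul hX hY (hf i) (contMDiffAt_coframe hx i hZ)

theorem smoothAt_extend {k : ℕ} {x : M} (v : TangentSpace (𝓡 n) x) :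
    SmoothAt k (extend (EuclideanSpace ℝ (Fin n)) v) x := by
  have : IsManifold (𝓡 n) ((k : ℕ∞ω) + 1) M := IsManifold.of_le (natCast_add_one_le_infty k)
  exact contMDiffAt_extend _ _ v

/-- The curvature is tensorial, on fields of class `C¹`, `C¹` and `C²`. -/
theorem riemann_eq_riemannAt {X Y Z : (x : M) → TangentSpace (𝓡 n) x} {x : M}
    (hX : SmoothAt (1 : ℕ) X x) (hY : SmoothAt (1 : ℕ) Y x) (hZ : SmoothAt (2 : ℕ) Z x) :
    g.riemann X Y Z x = g.riemannAt x (X x) (Y x) (Z x) := by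
  have hXe := (smoothAt_extend (k := 1) (X x)).diffAt one_ne_zero
  have hYe := (smoothAt_extend (k := 1) (Y x)).diffAt one_ne_zero
  have h1 : g.riemannAt x (X x) (Y x) (Z x) = g.riemann X (extend (EuclideanSpace ℝ (Fin n)) (Y x))
      (extend (EuclideanSpace ℝ (Fin n)) (Z x)) x :=
    (g.riemann_tensorial_left (smoothAt_extend (Z x))).pointwise hXe (hX.diffAt one_ne_zero)
      (extend_apply_self _ _)
  have h2 : g.riemann (extend (EuclideanSpace ℝ (Fin n)) (Y x)) X
      (extend (EuclideanSpace ℝ (Fin n)) (Z x)) x =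
      g.riemann Y X (extend (EuclideanSpace ℝ (Fin n)) (Z x)) x :=
    (g.riemann_tensorial_left (smoothAt_extend (Z x))).pointwise hYe (hY.diffAt one_ne_zero)
      (extend_apply_self _ _)
  rw [h1, g.riemann_swap X (extend _ (Y x)), h2, ← g.riemann_swap, g.riemann_eq_sum hX hY hZ,
    g.riemann_eq_sum hX hY (smoothAt_extend (Z x)), extend_apply_self]

end Curvature

/-! ### Bochner's identity -/

section Derivative

variable {n : ℕ} {M : Type*} [TopologicalSpace M] [ChartedSpace (EuclideanSpace ℝ (Fin n)) M]

theorem mvfderiv_congr {f f' : M → ℝ} {x : M} (h : f =ᶠ[𝓝 x] f') :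
    mvfderiv (𝓡 n) f x = mvfderiv (𝓡 n) f' x := by
  rw [mvfderiv, mvfderiv, h.mfderiv_eq]
  rfl

theorem mvfderiv_sum {ι : Type} (s : Finset ι) {f : ι → M → ℝ} {x : M}
    (hf : ∀ i, MDifferentiableAt (𝓡 n) 𝓘(ℝ) (f i) x) (v : TangentSpace (𝓡 n) x) :
    mvfderiv (𝓡 n) (fun y ↦ ∑ i ∈ s, f i y) x v = ∑ i ∈ s, mvfderiv (𝓡 n) (f i) x v := by
  classical
  induction s using Finset.induction_on with
  | empty =>
    simp only [Finset.sum_empty, mvfderiv_const]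
    rfl
  | insert a s ha ih =>
    simp only [Finset.sum_insert ha]
    have h : MDifferentiableAt (𝓡 n) 𝓘(ℝ) (fun y ↦ ∑ i ∈ s, f i y) x := by
      have h' : MDifferentiableAt (𝓡 n) 𝓘(ℝ) (∑ i ∈ s, f i) x :=
        MDifferentiableAt.sum fun i _ ↦ hf i
      rwa [Finset.sum_fn] at h'
    rw [mvfderiv_fun_add (hf a) h, ← ih]
    rfl

end Derivative

section Bochner

variable {n : ℕ} {M : Type*} [TopologicalSpace M]
  [ChartedSpace (EuclideanSpace ℝ (Fin n)) M] [IsManifold (𝓡 n) ∞ M] (g : LorentzianMetric n M)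

theorem orthonormalBasis_repr (x : M) (v : TangentSpace (𝓡 n) x) (i : Fin n) :
    (g.orthonormalBasis x).repr v i =
      g.inner x (g.orthonormalBasis x i) (g.orthonormalBasis x i) *
        g.inner x v (g.orthonormalBasis x i) := by
  conv_rhs => rw [← (g.orthonormalBasis x).sum_repr v]
  simp only [map_sum, map_smul, _root_.sum_apply, _root_.smul_apply, inner_orthonormalBasis,
    smul_eq_mul, mul_ite, mul_zero, Finset.sum_ite_eq', Finset.mem_univ, if_true]
  split_ifs <;> ring

theorem trace_eq_sum_orthonormalBasis (x : M)
    (A : TangentSpace (𝓡 n) x →ₗ[ℝ] TangentSpace (𝓡 n) x) :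
    LinearMap.trace ℝ _ A = ∑ i, g.inner x (g.orthonormalBasis x i) (g.orthonormalBasis x i) *
        g.inner x (A (g.orthonormalBasis x i)) (g.orthonormalBasis x i) := by
  rw [LinearMap.trace_eq_matrix_trace ℝ (g.orthonormalBasis x)]
  simp only [Matrix.trace, Matrix.diag_apply, LinearMap.toMatrix_apply, orthonormalBasis_repr]

theorem inner_self_eq_sum (x : M) (v : TangentSpace (𝓡 n) x) :
    g.inner x v v = ∑ i, g.inner x (g.orthonormalBasis x i) (g.orthonormalBasis x i) *
        g.inner x v (g.orthonormalBasis x i) ^ 2 := by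
  conv_lhs => enter [2]; rw [← (g.orthonormalBasis x).sum_repr v]
  simp only [map_sum, map_smul, orthonormalBasis_repr, smul_eq_mul]
  exact Finset.sum_congr rfl fun i _ ↦ by ring

/-- `g(Hess_f, Hess_f)` is the trace of the square of the Hessian. -/
theorem trace_hess_comp_hess {f : M → ℝ} {x : M} (hf : ContMDiffAt (𝓡 n) 𝓘(ℝ) 2 f x) :
    LinearMap.trace ℝ _ ((g.hess f x).toLinearMap ∘ₗ (g.hess f x).toLinearMap) = g.hessSq f x := by
  rw [g.trace_eq_sum_orthonormalBasis, hessSq]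
  refine Finset.sum_congr rfl fun i _ ↦ ?_
  have h : g.inner x (((g.hess f x).toLinearMap ∘ₗ (g.hess f x).toLinearMap)
      (g.orthonormalBasis x i)) (g.orthonormalBasis x i) = g.inner x
      (g.hess f x (g.orthonormalBasis x i)) (g.hess f x (g.orthonormalBasis x i)) :=
    g.inner_hess_comm hf _ _
  rw [h, g.inner_self_eq_sum x (g.hess f x _), Finset.mul_sum]
  exact Finset.sum_congr rfl fun j _ ↦ by rw [hessForm]; ring

/-- The Ricci curvature as a trace in the coordinate frame instead of an orthonormal basis. -/
theorem sum_coframe_riemann {N : (x : M) → TangentSpace (𝓡 n) x} {x : M}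
    (hN : SmoothAt (2 : ℕ) N x) :
    ∑ i, coframe x i x (g.riemann (frame x i) N N x) = g.ric x (N x) (N x) := by
  have hx := (eventually_mem_baseSet (n := n) x).self_of_nhds
  have hN1 : SmoothAt (1 : ℕ) N x := hN.of_le (by norm_num)
  -- the endomorphism `v ↦ R(v, N)N` of `T_x M`, whose trace is computed in both bases
  let K := (g.riemann_tensorial_left (Y := N) hN).mkHom
  have hK : ∀ {X : (x : M) → TangentSpace (𝓡 n) x}, SmoothAt (1 : ℕ) X x →
      K (X x) = g.riemann X N N x :=
    fun hX ↦ TensorialAt.mkHom_apply _ (hX.diffAt one_ne_zero)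
  have hf : ∀ i, SmoothAt (1 : ℕ) (frame x i) x := fun i ↦
    (smoothAt_frame hx i).of_le (natCast_le_infty _)
  have h1 := trace_eq_sum_coframe hx K.toLinearMap
  rw [g.trace_eq_sum_orthonormalBasis] at h1
  rw [ric]
  refine Eq.trans ?_ (h1.symm.trans ?_)
  · exact Finset.sum_congr rfl fun i _ ↦ congrArg _ (hK (hf i)).symm
  · refine Finset.sum_congr rfl fun i _ ↦ ?_
    have h2 := hK (smoothAt_extend (g.orthonormalBasis x i))
    rw [g.riemann_eq_riemannAt (smoothAt_extend _) hN1 hN] at h2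
    simp only [extend_apply_self] at h2
    rw [← h2]
    rfl

/-- The derivative of the divergence: the trace commutes with covariant derivation. -/
theorem mvfderiv_div {N : (x : M) → TangentSpace (𝓡 n) x} {x : M}
    (hN : SmoothAt (2 : ℕ) N x) (w : TangentSpace (𝓡 n) x) :
    mvfderiv (𝓡 n) (g.div N) x w = ∑ i, coframe x i x
      (g.leviCivita (fun y ↦ g.leviCivita N y (frame x i y)) x w -
        g.leviCivita N x (g.leviCivita (frame x i) x w)) := by
  have hx := (eventually_mem_baseSet (n := n) x).self_of_nhds
  have hf : ∀ i, DiffAt (frame x i) x := fun i ↦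
    SmoothAt.diffAt (k := 1) ((smoothAt_frame hx i).of_le (natCast_le_infty _)) one_ne_zero
  have hA : ∀ i, DiffAt (fun y ↦ g.leviCivita N y (frame x i y)) x := fun i ↦
    g.diffAt_leviCivita (hf i) hN
  have ha : ∀ i j, MDifferentiableAt (𝓡 n) 𝓘(ℝ)
      (fun y ↦ coframe x j y (g.leviCivita N y (frame x i y))) x := fun i j ↦
    mdifferentiableAt_coframe hx j (hA i)
  have hdiv : mvfderiv (𝓡 n) (g.div N) x w =
      ∑ i, mvfderiv (𝓡 n) (fun y ↦ coframe x i y (g.leviCivita N y (frame x i y))) x w := by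
    have h : g.div N =ᶠ[𝓝 x] fun y ↦ ∑ i, coframe x i y (g.leviCivita N y (frame x i y)) := by
      filter_upwards [eventually_mem_baseSet (n := n) x] with y hy
      exact trace_eq_sum_coframe hy _
    rw [mvfderiv_congr h, mvfderiv_sum _ fun i ↦ ha i i]
  have hcov : ∀ i, g.leviCivita (fun y ↦ g.leviCivita N y (frame x i y)) x w =
      ∑ j, (coframe x j x (g.leviCivita N x (frame x i x)) • g.leviCivita (frame x j) x w +
        mvfderiv (𝓡 n) (fun y ↦ coframe x j y (g.leviCivita N y (frame x i y))) x w •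
          frame x j x) := by
    intro i
    have hd : ∀ j, DiffAt
        (fun y ↦ coframe x j y (g.leviCivita N y (frame x i y)) • frame x j y) x :=
      fun j ↦ (ha i j).smul_section (hf j)
    rw [g.leviCivita_congr (MDifferentiableAt.sum_section fun j (_ : j ∈ Finset.univ) ↦ hd j)
      ((eventually_mem_baseSet (n := n) x).mono fun y hy ↦ (sum_coframe_smul_frame hy _).symm),
      g.leviCivita_sum _ hd]
    exact Finset.sum_congr rfl fun j _ ↦ g.leviCivita_smul (ha i j) (hf j) w
  have hcf : ∀ i j, coframe (n := n) x i x (frame x j x) = if j = i then 1 else 0 := by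
    intro i j
    rw [← frameBasis_repr hx, ← frameBasis_apply hx, Module.Basis.repr_self, Finsupp.single_apply]
  have hcon : ∀ i, coframe x i x (g.leviCivita N x (g.leviCivita (frame x i) x w)) =
      ∑ j, coframe x j x (g.leviCivita (frame x i) x w) *
        coframe x i x (g.leviCivita N x (frame x j x)) := by
    intro i
    conv_lhs => rw [← sum_coframe_smul_frame hx (g.leviCivita (frame x i) x w)]
    simp
  simp only [map_sub, hcon, hcov, Finset.sum_sub_distrib, map_sum, map_add, map_smul, smul_eq_mul,
    Finset.sum_add_distrib, hcf, hdiv]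
  -- the two double sums over the connection coefficients cancel after a swap of the indices
  rw [Finset.sum_comm (f := fun i j ↦ coframe (n := n) x j x (g.leviCivita (frame x i) x w) *
    coframe (n := n) x i x (g.leviCivita N x (frame x j x)))]
  simp [mul_comm]

/-- **Bochner's identity** for a vector field of class `C²`. -/
theorem div_leviCivita_self {N : (x : M) → TangentSpace (𝓡 n) x} {x : M}
    (hN : SmoothAt (2 : ℕ) N x) :
    g.div (fun y ↦ g.leviCivita N y (N y)) x =
      LinearMap.trace ℝ _ ((g.leviCivita N x).toLinearMap ∘ₗ (g.leviCivita N x).toLinearMap)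
      + mvfderiv (𝓡 n) (g.div N) x (N x) + g.ric x (N x) (N x) := by
  have hx := (eventually_mem_baseSet (n := n) x).self_of_nhds
  have hNd := hN.diffAt two_ne_zero
  have hf : ∀ i, DiffAt (frame x i) x := fun i ↦
    SmoothAt.diffAt (k := 1) ((smoothAt_frame hx i).of_le (natCast_le_infty _)) one_ne_zero
  rw [g.mvfderiv_div hN, ← g.sum_coframe_riemann hN, div, trace_eq_sum_coframe hx,
    trace_eq_sum_coframe hx, ← Finset.sum_add_distrib, ← Finset.sum_add_distrib]
  refine Finset.sum_congr rfl fun i _ ↦ ?_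
  rw [← map_add, ← map_add]
  congr 1
  rw [riemann, g.mlieBracket_eq (hf i) hNd, map_sub]
  simp only [LinearMap.comp_apply, ContinuousLinearMap.coe_coe]
  abel

end Bochner

/-! ### Real powers and a polynomial derivative -/

section RealPower

variable {n : ℕ} {M : Type*} [TopologicalSpace M] [ChartedSpace (EuclideanSpace ℝ (Fin n)) M]

theorem contMDiffAt_rpow {k : ℕ∞ω} {f : M → ℝ} {x : M} (hf : ContMDiffAt (𝓡 n) 𝓘(ℝ) k f x)
    (h0 : f x ≠ 0) (r : ℝ) : ContMDiffAt (𝓡 n) 𝓘(ℝ) k (fun y ↦ f y ^ r) x :=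
  (Real.contDiffAt_rpow_const_of_ne h0).contMDiffAt.comp x hf

theorem mvfderiv_rpow {f : M → ℝ} {x : M} (hf : MDifferentiableAt (𝓡 n) 𝓘(ℝ) f x)
    (h0 : f x ≠ 0) (r : ℝ) (v : TangentSpace (𝓡 n) x) :
    mvfderiv (𝓡 n) (fun y ↦ f y ^ r) x v = r * f x ^ (r - 1) * mvfderiv (𝓡 n) f x v := by
  have h1 := Real.hasDerivAt_rpow_const (x := f x) (p := r) (Or.inl h0)
  have h2 := mvfderiv_comp_apply x (g := fun t : ℝ ↦ t ^ r)
    h1.differentiableAt.mdifferentiableAt hf v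
  refine h2.trans ?_
  have h3 : mvfderiv 𝓘(ℝ) (fun t : ℝ ↦ t ^ r) (f x) = fderiv ℝ (fun t : ℝ ↦ t ^ r) (f x) := by
    rw [mvfderiv, mfderiv_eq_fderiv]; rfl
  rw [h3, h1.hasFDerivAt.fderiv]
  exact mul_comm _ _

end RealPower

/-- The derivative at `0` of a cubic polynomial is its linear coefficient. -/
theorem hasDerivAt_cubic {F : ℝ → ℝ} (a b c d : ℝ)
    (hF : ∀ t, F t = a + b * t + c * t ^ 2 + d * t ^ 3) : HasDerivAt F b 0 := by
  have h1 : HasDerivAt (fun t : ℝ ↦ a + b * t + c * t ^ 2 + d * t ^ 3)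
      (b * 1 + c * (2 * 0 ^ 1) + d * (3 * 0 ^ 2)) 0 :=
    ((((hasDerivAt_id (0 : ℝ)).const_mul b).const_add a).add
      ((hasDerivAt_pow 2 (0 : ℝ)).const_mul c)).add ((hasDerivAt_pow 3 (0 : ℝ)).const_mul d)
  rw [funext hF]
  simpa using h1

/-! ### The interior of the future cone -/

section Timelike

variable {n : ℕ} {M : Type*} [TopologicalSpace M]
  [ChartedSpace (EuclideanSpace ℝ (Fin n)) M] [IsManifold (𝓡 n) ∞ M] (g : LorentzianMetric n M)

theorem continuous_inner_self :
    Continuous (fun v : TangentBundle (𝓡 n) M ↦ g.inner v.proj v.snd v.snd) := by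
  have h : ContMDiff (𝓡 n).tangent _ 0
      (fun v : TangentBundle (𝓡 n) M ↦ TotalSpace.mk' ℝ (E := Bundle.Trivial M ℝ) v.proj
        (g.inner v.proj v.snd v.snd)) :=
    ContMDiff.clm_bundle_apply₂ (F₁ := EuclideanSpace ℝ (Fin n))
      (F₂ := EuclideanSpace ℝ (Fin n)) (F₃ := ℝ) (E₃ := Bundle.Trivial M ℝ)
      (b := fun v : TangentBundle (𝓡 n) M ↦ v.proj)
      (ψ := fun v ↦ g.inner v.proj) (v := fun v ↦ v.snd) (w := fun v ↦ v.snd)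
      ((g.contMDiff.of_le (by simp)).comp (contMDiff_proj _))
      contMDiff_id contMDiff_id
  exact continuous_iff_continuousAt.2 fun v ↦ ((contMDiffAt_totalSpace.1 (h v)).2).continuousAt

/-- A vector in the interior of the future cone is time-like. All vectors of the cone are causal;
were `v` null, then `s ↦ g(v + s w, v + s w)` would have a local maximum at `0` for every `w`,
whence `v = 0`, but `0` has space-like vectors arbitrarily close to it. -/
theorem inner_self_neg_of_mem_interior (hn : 2 ≤ n) (C : g.TimeOrientation) {x : M}
    {v : TangentSpace (𝓡 n) x} (hv : (⟨x, v⟩ : TangentBundle (𝓡 n) M) ∈ interior C.cone) :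
    g.inner x v v < 0 := by
  obtain ⟨X, -, -, hX⟩ := C.exists_field
  have hle : ∀ w ∈ C.cone, g.inner w.proj w.snd w.snd ≤ 0 := by
    intro w hw
    rw [hX] at hw
    exact closure_minimal (fun w hw ↦ le_of_lt hw.1)
      (isClosed_le g.continuous_inner_self continuous_const) hw
  have hpert : ∀ w : TangentSpace (𝓡 n) x, ∀ᶠ s : ℝ in 𝓝 0,
      g.inner x v v + 2 * s * g.inner x v w + s ^ 2 * g.inner x w w ≤ 0 := by
    intro w
    have hc : Continuous (fun s : ℝ ↦ (⟨x, v + s • w⟩ : TangentBundle (𝓡 n) M)) :=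
      (FiberBundle.continuous_totalSpaceMk (EuclideanSpace ℝ (Fin n)) (TangentSpace (𝓡 n)) x).comp
        (by fun_prop)
    have h0 : interior C.cone ∈ 𝓝 (⟨x, v + (0 : ℝ) • w⟩ : TangentBundle (𝓡 n) M) := by
      simpa using isOpen_interior.mem_nhds hv
    filter_upwards [hc.continuousAt.eventually h0] with s hs
    have := hle _ (interior_subset hs)
    simp only [map_add, map_smul, _root_.add_apply, _root_.smul_apply, smul_eq_mul,
      g.symm x w v] at this
    linarith
  refine lt_of_le_of_ne (by simpa using (hpert 0).self_of_nhds) fun hvv ↦ ?_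
  rw [hvv] at hpert
  have hvw : ∀ w, g.inner x v w = 0 := by
    intro w
    have hd : HasDerivAt
        (fun s : ℝ ↦ 0 + 2 * s * g.inner x v w + s ^ 2 * g.inner x w w) (2 * g.inner x v w) 0 :=
      hasDerivAt_cubic 0 _ (g.inner x w w) 0 fun s ↦ by ring
    have hmax : IsLocalMax (fun s : ℝ ↦ 0 + 2 * s * g.inner x v w + s ^ 2 * g.inner x w w) 0 := by
      filter_upwards [hpert w] with s hs
      simpa using hs
    linarith [hmax.hasDerivAt_eq_zero hd]
  have hv0 := g.eq_zero_of_inner x v hvw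
  -- `n ≥ 2` provides the space-like vector of index `1` of an orthonormal basis
  obtain ⟨s, hs, hs0⟩ := ((hpert (g.orthonormalBasis x ⟨1, hn⟩)).filter_mono
    nhdsWithin_le_nhds |>.and (self_mem_nhdsWithin (s := Ioi (0 : ℝ)))).exists
  rw [hvw, inner_orthonormalBasis] at hs
  simp at hs hs0
  nlinarith

end Timelike

/-! ### The linearized `q`-Box operator -/

section Linearization

variable {n : ℕ} {M : Type*} [TopologicalSpace M]
  [ChartedSpace (EuclideanSpace ℝ (Fin n)) M] [IsManifold (𝓡 n) ∞ M] (g : LorentzianMetric n M)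

theorem contMDiffAt_gradSq {k : ℕ} {f : M → ℝ} {x : M}
    (hf : ContMDiffAt (𝓡 n) 𝓘(ℝ) ((k + 1 : ℕ) : ℕ∞ω) f x) :
    ContMDiffAt (𝓡 n) 𝓘(ℝ) k (g.gradSq f) x :=
  g.contMDiffAt_inner (natCast_le_infty k) (g.smoothAt_grad hf) (g.smoothAt_grad hf)

/-- `□^q f = w^p div (∇ f) + p w^(p-1) dw(∇ f)` where `w = -g(∇ f, ∇ f) > 0` and
`p = (q - 2) / 2`. -/
theorem qBox_eq (q : ℝ) {f : M → ℝ} {x : M} (hf : ContMDiffAt (𝓡 n) 𝓘(ℝ) 2 f x)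
    (h0 : g.gradSq f x < 0) :
    g.qBox q f x = (-g.gradSq f x) ^ ((q - 2) / 2) * g.div (g.grad f) x +
      (q - 2) / 2 * (-g.gradSq f x) ^ ((q - 2) / 2 - 1) *
        mvfderiv (𝓡 n) (fun y ↦ -g.gradSq f y) x (g.grad f x) := by
  have hG := (g.smoothAt_grad (k := 1) hf).diffAt one_ne_zero
  have hS := (g.contMDiffAt_gradSq (k := 1) hf)
  have hW : MDifferentiableAt (𝓡 n) 𝓘(ℝ) (fun y ↦ -g.gradSq f y) x :=
    hS.neg.mdifferentiableAt (by simp)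
  have hp : MDifferentiableAt (𝓡 n) 𝓘(ℝ) (fun y ↦ (-g.gradSq f y) ^ ((q - 2) / 2)) x :=
    (contMDiffAt_rpow (f := fun y ↦ -g.gradSq f y) hS.neg
      (by linarith) _).mdifferentiableAt (by simp)
  rw [qBox, g.div_congr (Y' := fun y ↦ (-g.gradSq f y) ^ ((q - 2) / 2) • g.grad f y)
    (hp.smul_section hG), g.div_smul hp hG, mvfderiv_rpow hW (by linarith)]
  filter_upwards [hS.continuousAt.eventually_lt_const h0] with y hy
  rw [qGrad, neg_neg, abs_of_neg hy]

theorem grad_add_smul {f u : M → ℝ} {x : M} (hf : MDifferentiableAt (𝓡 n) 𝓘(ℝ) f x)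
    (hu : MDifferentiableAt (𝓡 n) 𝓘(ℝ) u x) (t : ℝ) :
    g.grad (fun y ↦ f y + t * u y) x = g.grad f x + t • g.grad u x := by
  refine g.ext_inner x fun w ↦ ?_
  have ht : MDifferentiableAt (𝓡 n) 𝓘(ℝ) (fun _ : M ↦ t) x := mdifferentiableAt_const
  simp only [map_add, map_smul, _root_.add_apply, _root_.smul_apply, inner_grad]
  have htu : MDifferentiableAt (𝓡 n) 𝓘(ℝ) (fun y ↦ t * u y) x := ht.mul hu
  rw [mvfderiv_fun_add hf htu, mvfderiv_fun_mul ht hu]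
  simp [mvfderiv_const]

/-- The linearization of the `q`-Box operator at `f`, with `w = -g(∇ f, ∇ f)`, `p = (q - 2) / 2` and
`α = g(∇ f, ∇ u)`:
`L u = w^p div (∇ u) + p w^(p-1) (-2 α div (∇ f) + dw(∇ u) - 2 dα(∇ f))
  - 2 p (p-1) w^(p-2) α dw(∇ f)`. -/
theorem hasDerivAt_qBox (q : ℝ) {f u : M → ℝ} {x : M} (hf : ContMDiffAt (𝓡 n) 𝓘(ℝ) 2 f x)
    (hu : ContMDiffAt (𝓡 n) 𝓘(ℝ) 2 u x) (h0 : g.gradSq f x < 0) :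
    HasDerivAt (fun t : ℝ ↦ g.qBox q (fun y ↦ f y + t * u y) x)
      ((-g.gradSq f x) ^ ((q - 2) / 2) * g.div (g.grad u) x
        + (q - 2) / 2 * (-g.gradSq f x) ^ ((q - 2) / 2 - 1) *
          (-2 * g.inner x (g.grad f x) (g.grad u x) * g.div (g.grad f) x
            + mvfderiv (𝓡 n) (fun y ↦ -g.gradSq f y) x (g.grad u x)
            - 2 * mvfderiv (𝓡 n) (fun y ↦ g.inner y (g.grad f y) (g.grad u y)) x (g.grad f x))
        + (q - 2) / 2 * ((q - 2) / 2 - 1) * (-g.gradSq f x) ^ ((q - 2) / 2 - 2) *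
          (-2 * g.inner x (g.grad f x) (g.grad u x)) *
            mvfderiv (𝓡 n) (fun y ↦ -g.gradSq f y) x (g.grad f x)) 0 := by
  have hGf := (g.smoothAt_grad (k := 1) hf).diffAt one_ne_zero
  have hGu := (g.smoothAt_grad (k := 1) hu).diffAt one_ne_zero
  have hw := g.mdifferentiableAt_inner hGf hGf
  have hα := g.mdifferentiableAt_inner hGf hGu
  have hβ := g.mdifferentiableAt_inner hGu hGu
  set p := (q - 2) / 2
  set w := -g.gradSq f x with hwdef
  set α := g.inner x (g.grad f x) (g.grad u x) with hαdef
  set β := g.gradSq u x with hβdef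
  set dw := mvfderiv (𝓡 n) (fun y ↦ -g.gradSq f y) x
  set dα := mvfderiv (𝓡 n) (fun y ↦ g.inner y (g.grad f y) (g.grad u y)) x
  set dβ := mvfderiv (𝓡 n) (fun y ↦ g.gradSq u y) x
  have hgrad : ∀ t : ℝ, ∀ᶠ y in 𝓝 x,
      g.grad (fun y ↦ f y + t * u y) y = g.grad f y + t • g.grad u y := by
    intro t
    filter_upwards [eventually_contMDiffAt (k := 2) hf,
      eventually_contMDiffAt (k := 2) hu] with y h1 h2
    exact g.grad_add_smul (h1.mdifferentiableAt (by simp)) (h2.mdifferentiableAt (by simp)) t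
  have hsq : ∀ t : ℝ, ∀ᶠ y in 𝓝 x, -g.gradSq (fun y ↦ f y + t * u y) y =
      -g.gradSq f y + (-2 * t) * g.inner y (g.grad f y) (g.grad u y) + (-t ^ 2) * g.gradSq u y := by
    intro t
    filter_upwards [hgrad t] with y hy
    simp only [gradSq, hy, map_add, map_smul, _root_.add_apply, _root_.smul_apply, smul_eq_mul,
      g.symm y (g.grad u y) (g.grad f y)]
    ring
  have hdsq : ∀ t : ℝ, ∀ v, mvfderiv (𝓡 n) (fun y ↦ -g.gradSq (fun y ↦ f y + t * u y) y) x v =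
      dw v + (-2 * t) * dα v + (-t ^ 2) * dβ v := by
    intro t v
    have h1 : MDifferentiableAt (𝓡 n) 𝓘(ℝ) (fun _ : M ↦ -2 * t) x := mdifferentiableAt_const
    have h2 : MDifferentiableAt (𝓡 n) 𝓘(ℝ) (fun _ : M ↦ -t ^ 2) x := mdifferentiableAt_const
    have h3 : MDifferentiableAt (𝓡 n) 𝓘(ℝ) (fun y ↦ -g.gradSq f y) x := hw.neg
    have h4 : MDifferentiableAt (𝓡 n) 𝓘(ℝ)
      (fun y ↦ (-2 * t) * g.inner y (g.grad f y) (g.grad u y)) x := h1.mul hα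
    have h5 : MDifferentiableAt (𝓡 n) 𝓘(ℝ) (fun y ↦ (-t ^ 2) * g.gradSq u y) x := h2.mul hβ
    have h34 : MDifferentiableAt (𝓡 n) 𝓘(ℝ) (fun y ↦ -g.gradSq f y +
      (-2 * t) * g.inner y (g.grad f y) (g.grad u y)) x := h3.add h4
    rw [mvfderiv_congr (hsq t), mvfderiv_fun_add h34 h5, mvfderiv_fun_add h3 h4,
      mvfderiv_fun_mul h1 hα,
      mvfderiv_fun_mul h2 (f := fun _ ↦ -t ^ 2) (g := fun y ↦ g.gradSq u y) hβ]
    simp [mvfderiv_const, dw, dα, dβ]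
  have hdiv : ∀ t : ℝ, g.div (g.grad (fun y ↦ f y + t * u y)) x =
      g.div (g.grad f) x + t * g.div (g.grad u) x := by
    intro t
    have ht : MDifferentiableAt (𝓡 n) 𝓘(ℝ) (fun _ : M ↦ t) x := mdifferentiableAt_const
    have h1 : DiffAt (fun y ↦ t • g.grad u y) x := ht.smul_section hGu
    have h2 : DiffAt (fun y ↦ g.grad f y + t • g.grad u y) x := mdifferentiableAt_add_section hGf h1
    rw [g.div_congr h2 (hgrad t), g.div_add hGf h1, g.div_smul ht hGu]
    simp [mvfderiv_const]
  -- the exact dependence on `t`, as long as the gradient of `f + t u` stays time-like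
  have hform : (fun t : ℝ ↦ g.qBox q (fun y ↦ f y + t * u y) x) =ᶠ[𝓝 0] fun t ↦
      (w + (-2 * t) * α + (-t ^ 2) * β) ^ p * (g.div (g.grad f) x + t * g.div (g.grad u) x) +
      p * (w + (-2 * t) * α + (-t ^ 2) * β) ^ (p - 1) *
        (dw (g.grad f x) + t * dw (g.grad u x)
          + (-2 * t) * (dα (g.grad f x) + t * dα (g.grad u x))
          + (-t ^ 2) * (dβ (g.grad f x) + t * dβ (g.grad u x))) := by
    have hcont : ContinuousAt (fun t : ℝ ↦ w + (-2 * t) * α + (-t ^ 2) * β) 0 := by fun_prop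
    filter_upwards [hcont.eventually_const_lt (u := 0) (by simp; linarith)] with t ht
    have h1 := (hsq t).self_of_nhds
    have h2 : ContMDiffAt (𝓡 n) 𝓘(ℝ) 2 (fun y ↦ f y + t * u y) x :=
      hf.add (contMDiffAt_const.mul hu)
    rw [g.qBox_eq q h2 (by linarith), h1, hdiv, hdsq, (hgrad t).self_of_nhds]
    simp only [map_add, map_smul, smul_eq_mul]
    ring
  refine HasDerivAt.congr_of_eventuallyEq ?_ hform
  have hW : HasDerivAt (fun t : ℝ ↦ w + (-2 * t) * α + (-t ^ 2) * β) (-2 * α) 0 :=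
    hasDerivAt_cubic w _ (-β) 0 fun t ↦ by ring
  have hWp : ∀ r : ℝ, HasDerivAt (fun t : ℝ ↦ (w + (-2 * t) * α + (-t ^ 2) * β) ^ r)
      (-2 * α * r * w ^ (r - 1)) 0 := by
    intro r
    have := hW.rpow_const (p := r) (Or.inl (by simp; linarith))
    simpa using this
  have hA : HasDerivAt (fun t : ℝ ↦ g.div (g.grad f) x + t * g.div (g.grad u) x)
      (g.div (g.grad u) x) 0 :=
    hasDerivAt_cubic (g.div (g.grad f) x) _ 0 0 fun t ↦ by ring
  have hB : HasDerivAt (fun t : ℝ ↦ dw (g.grad f x) + t * dw (g.grad u x)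
      + (-2 * t) * (dα (g.grad f x) + t * dα (g.grad u x))
      + (-t ^ 2) * (dβ (g.grad f x) + t * dβ (g.grad u x)))
      (dw (g.grad u x) - 2 * dα (g.grad f x)) 0 :=
    hasDerivAt_cubic (dw (g.grad f x)) _ (-2 * dα (g.grad u x) - dβ (g.grad f x))
      (-dβ (g.grad u x)) fun t ↦ by ring
  have h := ((hWp p).mul hA).add (((hWp (p - 1)).const_mul p).mul hB)
  refine h.congr_deriv ?_
  have hp2 : p - 1 - 1 = p - 2 := by ring
  simp [hp2]
  ring

end Linearization

/-! ### The `q`-Bochner identity -/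

section QBochner

variable {n : ℕ} {M : Type*} [TopologicalSpace M]
  [ChartedSpace (EuclideanSpace ℝ (Fin n)) M] [IsManifold (𝓡 n) ∞ M] (g : LorentzianMetric n M)

/-- `d(-g(N, N)) = -2 g(∇_N N, ·)` for `N = ∇ f`. -/
theorem mvfderiv_neg_gradSq {f : M → ℝ} {x : M} (hf : ContMDiffAt (𝓡 n) 𝓘(ℝ) 2 f x)
    (v : TangentSpace (𝓡 n) x) :
    mvfderiv (𝓡 n) (fun y ↦ -g.gradSq f y) x v =
      -2 * g.inner x (g.hess f x (g.grad f x)) v := by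
  have hG := (g.smoothAt_grad (k := 1) hf).diffAt one_ne_zero
  have h1 := g.leviCivita_metric hG hG v
  change mvfderiv (𝓡 n) (fun y ↦ -g.inner y (g.grad f y) (g.grad f y)) x v = _
  rw [mvfderiv_fun_neg, _root_.neg_apply]
  rw [h1, show g.leviCivita (g.grad f) x = g.hess f x from rfl, g.symm x (g.hess f x v),
    g.inner_hess_comm hf]
  ring

/-- The function `w ^ (q / 2) / q`, `w = -g(∇ f, ∇ f)`, has gradient `-w ^ ((q - 2) / 2) ∇_N N`
with `N = ∇ f`. -/
theorem grad_rpow_neg_gradSq {q : ℝ} (hq : q ≠ 0) {f : M → ℝ} {x : M}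
    (hf : ContMDiffAt (𝓡 n) 𝓘(ℝ) 2 f x) (h0 : g.gradSq f x < 0) :
    g.grad (fun y ↦ (-g.gradSq f y) ^ (q / 2) / q) x =
      -(-g.gradSq f x) ^ ((q - 2) / 2) • g.hess f x (g.grad f x) := by
  have hw : MDifferentiableAt (𝓡 n) 𝓘(ℝ) (fun y ↦ -g.gradSq f y) x :=
    (g.contMDiffAt_gradSq (k := 1) hf).neg.mdifferentiableAt (by simp)
  have hr : MDifferentiableAt (𝓡 n) 𝓘(ℝ) (fun y ↦ (-g.gradSq f y) ^ (q / 2)) x :=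
    (contMDiffAt_rpow (f := fun y ↦ -g.gradSq f y) (g.contMDiffAt_gradSq (k := 1) hf).neg
      (by linarith) _).mdifferentiableAt (by simp)
  have hc : MDifferentiableAt (𝓡 n) 𝓘(ℝ) (fun _ : M ↦ q⁻¹) x := mdifferentiableAt_const
  have h2 : (fun y ↦ (-g.gradSq f y) ^ (q / 2) / q) = fun y ↦ q⁻¹ * (-g.gradSq f y) ^ (q / 2) := by
    funext y
    ring
  refine g.ext_inner x fun v ↦ ?_
  rw [inner_grad, h2, mvfderiv_fun_mul hc hr]
  simp only [_root_.add_apply, _root_.smul_apply,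
    mvfderiv_rpow hw (by linarith : -g.gradSq f x ≠ 0),
    g.mvfderiv_neg_gradSq hf, map_smul, smul_eq_mul, mvfderiv_const]
  rw [show (q - 2) / 2 = q / 2 - 1 by ring]
  simp
  field_simp

theorem contMDiffAt_qBox (q : ℝ) {f : M → ℝ} {x : M} (hf : ContMDiffAt (𝓡 n) 𝓘(ℝ) 3 f x)
    (h0 : g.gradSq f x < 0) : ContMDiffAt (𝓡 n) 𝓘(ℝ) 1 (g.qBox q f) x := by
  have hN := g.smoothAt_grad (k := 2) hf
  have hN1 : SmoothAt (1 : ℕ) (g.grad f) x := hN.of_le (by norm_cast)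
  have hS := (g.contMDiffAt_gradSq (k := 2) hf).neg
  have hS1 := hS.of_le (m := 1) (by norm_cast)
  have h1 := ((contMDiffAt_rpow (f := fun y ↦ -g.gradSq f y) hS1 (by linarith) ((q - 2) / 2)).mul
    (g.contMDiffAt_div (k := 1) hN)).add
    (((contMDiffAt_const (c := (q - 2) / 2)).mul
      (contMDiffAt_rpow (f := fun y ↦ -g.gradSq f y) hS1 (by linarith) ((q - 2) / 2 - 1))).mul
      (contMDiffAt_mvfderiv_apply (k := 1) hS hN1))
  refine h1.congr_of_eventuallyEq ?_
  filter_upwards [eventually_contMDiffAt (k := 3) hf,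
    hS.continuousAt.eventually_const_lt (u := 0) (by simpa using h0)] with y hy hy0
  exact g.qBox_eq q (hy.of_le (by norm_cast)) (by simpa using hy0)

/-- The differential of `□^q f = w^p D - 2 p w^(p-1) h` where `N = ∇ f`,
`w = -g(N, N)`, `p = (q - 2) / 2`, `D = div N` and `h = g(∇_N N, N)`. -/
theorem mvfderiv_qBox (q : ℝ) {f : M → ℝ} {x : M} (hf : ContMDiffAt (𝓡 n) 𝓘(ℝ) 3 f x)
    (h0 : g.gradSq f x < 0) (v : TangentSpace (𝓡 n) x) :
    mvfderiv (𝓡 n) (g.qBox q f) x v =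
      (-g.gradSq f x) ^ ((q - 2) / 2) * mvfderiv (𝓡 n) (g.div (g.grad f)) x v
      + (q - 2) / 2 * (-g.gradSq f x) ^ ((q - 2) / 2 - 1) *
        mvfderiv (𝓡 n) (fun y ↦ -g.gradSq f y) x v * g.div (g.grad f) x
      - 2 * ((q - 2) / 2) * ((-g.gradSq f x) ^ ((q - 2) / 2 - 1) *
          mvfderiv (𝓡 n) (fun y ↦ g.hessForm f y (g.grad f y) (g.grad f y)) x v
        + ((q - 2) / 2 - 1) * (-g.gradSq f x) ^ ((q - 2) / 2 - 2) *
          mvfderiv (𝓡 n) (fun y ↦ -g.gradSq f y) x v *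
            g.hessForm f x (g.grad f x) (g.grad f x)) := by
  have hf2 := hf.of_le (m := 2) (by norm_cast)
  have hN := g.smoothAt_grad (k := 2) hf
  have hN1 : SmoothAt (1 : ℕ) (g.grad f) x := hN.of_le (by norm_cast)
  have hS := (g.contMDiffAt_gradSq (k := 1) hf2).neg
  have hw : MDifferentiableAt (𝓡 n) 𝓘(ℝ) (fun y ↦ -g.gradSq f y) x :=
    hS.mdifferentiableAt (by simp)
  have hr : ∀ r : ℝ, MDifferentiableAt (𝓡 n) 𝓘(ℝ) (fun y ↦ (-g.gradSq f y) ^ r) x := fun r ↦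
    (contMDiffAt_rpow (f := fun y ↦ -g.gradSq f y) hS (by linarith) _).mdifferentiableAt (by simp)
  have hD : MDifferentiableAt (𝓡 n) 𝓘(ℝ) (fun y ↦ g.div (g.grad f) y) x :=
    (g.contMDiffAt_div (k := 1) hN).mdifferentiableAt (by simp)
  have hh : MDifferentiableAt (𝓡 n) 𝓘(ℝ)
      (fun y ↦ g.hessForm f y (g.grad f y) (g.grad f y)) x :=
    g.mdifferentiableAt_inner ((g.smoothAt_leviCivita (k := 1) hN1 hN).diffAt one_ne_zero)
      (hN1.diffAt one_ne_zero)
  have hc : MDifferentiableAt (𝓡 n) 𝓘(ℝ) (fun _ : M ↦ -2 * ((q - 2) / 2)) x :=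
    mdifferentiableAt_const
  have hev : g.qBox q f =ᶠ[𝓝 x] fun y ↦
      (-g.gradSq f y) ^ ((q - 2) / 2) * g.div (g.grad f) y +
      (-2 * ((q - 2) / 2)) * ((-g.gradSq f y) ^ ((q - 2) / 2 - 1) *
        g.hessForm f y (g.grad f y) (g.grad f y)) := by
    filter_upwards [eventually_contMDiffAt (k := 3) hf,
      hS.continuousAt.eventually_const_lt (u := 0) (by simpa using h0)] with y hy hy0
    have hy2 := hy.of_le (m := 2) (by norm_cast)
    rw [g.qBox_eq q hy2 (by simpa using hy0), g.mvfderiv_neg_gradSq hy2, hessForm]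
    ring
  have hrD : MDifferentiableAt (𝓡 n) 𝓘(ℝ)
      (fun y ↦ (-g.gradSq f y) ^ ((q - 2) / 2) * g.div (g.grad f) y) x := (hr _).mul hD
  have hrh : MDifferentiableAt (𝓡 n) 𝓘(ℝ) (fun y ↦ (-g.gradSq f y) ^ ((q - 2) / 2 - 1) *
      g.hessForm f y (g.grad f y) (g.grad f y)) x := (hr _).mul hh
  have hcrh : MDifferentiableAt (𝓡 n) 𝓘(ℝ) (fun y ↦ (-2 * ((q - 2) / 2)) *
      ((-g.gradSq f y) ^ ((q - 2) / 2 - 1) * g.hessForm f y (g.grad f y) (g.grad f y))) x :=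
    hc.mul hrh
  rw [mvfderiv_congr hev, mvfderiv_fun_add hrD hcrh, mvfderiv_fun_mul (hr _) hD,
    mvfderiv_fun_mul hc hrh, mvfderiv_fun_mul (hr _) hh]
  have hp2 : (q - 2) / 2 - 1 - 1 = (q - 2) / 2 - 2 := by ring
  simp only [_root_.add_apply, _root_.smul_apply, smul_eq_mul, mvfderiv_const,
    mvfderiv_rpow hw (by linarith : -g.gradSq f x ≠ 0), hp2, _root_.zero_apply]
  simp
  ring

/-- The `q`-Bochner identity at a point where the gradient of `f` is time-like. -/
theorem qBochner {q : ℝ} (hq : q ≠ 0) {f : M → ℝ} {x : M} (hf : ContMDiffAt (𝓡 n) 𝓘(ℝ) 3 f x)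
    (h0 : g.gradSq f x < 0) :
    -g.qBoxLin q f (fun y ↦ (-g.gradSq f y) ^ (q / 2) / q) x =
      g.inner x (g.grad (g.qBox q f) x) (-g.qGrad q f x)
      + (q - 2) ^ 2 * |g.gradSq f x| ^ (q - 2) *
          (g.hessForm f x (g.grad f x) (g.grad f x) / |g.gradSq f x|) ^ 2
      + |g.gradSq f x| ^ (q - 2) * (g.ric x (g.grad f x) (g.grad f x) + g.hessSq f x)
      - 2 * (q - 2) * |g.gradSq f x| ^ (q - 3) *
          g.hessForm f x (g.grad f x) (g.hess f x (g.grad f x)) := by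
  have hf2 := hf.of_le (m := 2) (by norm_cast)
  have hN := g.smoothAt_grad (k := 2) hf
  have hN1 : SmoothAt (1 : ℕ) (g.grad f) x := hN.of_le (by norm_cast)
  have hS2 := (g.contMDiffAt_gradSq (k := 2) hf).neg
  have hS := (g.contMDiffAt_gradSq (k := 1) hf2).neg
  have hw : MDifferentiableAt (𝓡 n) 𝓘(ℝ) (fun y ↦ -g.gradSq f y) x :=
    hS.mdifferentiableAt (by simp)
  have hV : DiffAt (fun y ↦ g.hess f y (g.grad f y)) x :=
    (g.smoothAt_leviCivita (k := 1) hN1 hN).diffAt one_ne_zero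
  have hnr : MDifferentiableAt (𝓡 n) 𝓘(ℝ) (fun y ↦ -(-g.gradSq f y) ^ ((q - 2) / 2)) x :=
    ((contMDiffAt_rpow (f := fun y ↦ -g.gradSq f y) hS (by linarith) _).mdifferentiableAt
      (by simp)).neg
  have hu : ContMDiffAt (𝓡 n) 𝓘(ℝ) 2 (fun y ↦ (-g.gradSq f y) ^ (q / 2) / q) x :=
    (contMDiffAt_rpow (f := fun y ↦ -g.gradSq f y) hS2 (by linarith) _).div_const q
  have hgu : ∀ᶠ y in 𝓝 x, g.grad (fun y ↦ (-g.gradSq f y) ^ (q / 2) / q) y =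
      -(-g.gradSq f y) ^ ((q - 2) / 2) • g.hess f y (g.grad f y) := by
    filter_upwards [eventually_contMDiffAt (k := 3) hf,
      hS.continuousAt.eventually_const_lt (u := 0) (by simpa using h0)] with y hy hy0
    exact g.grad_rpow_neg_gradSq hq (hy.of_le (by norm_cast)) (by simpa using hy0)
  have hh : MDifferentiableAt (𝓡 n) 𝓘(ℝ)
      (fun y ↦ g.hessForm f y (g.grad f y) (g.grad f y)) x :=
    g.mdifferentiableAt_inner hV (hN1.diffAt one_ne_zero)
  have hdnr : ∀ v, mvfderiv (𝓡 n) (fun y ↦ -(-g.gradSq f y) ^ ((q - 2) / 2)) x v =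
      -((q - 2) / 2 * (-g.gradSq f x) ^ ((q - 2) / 2 - 1) *
        (-2 * g.inner x (g.hess f x (g.grad f x)) v)) := by
    intro v
    rw [mvfderiv_fun_neg, _root_.neg_apply, mvfderiv_rpow hw (by linarith),
      g.mvfderiv_neg_gradSq hf2]
  -- Bochner's identity and the product rule for `∇ u = -w ^ p ∇_N N`
  have hdiv : g.div (g.grad (fun y ↦ (-g.gradSq f y) ^ (q / 2) / q)) x =
      -(-g.gradSq f x) ^ ((q - 2) / 2) *
        (g.hessSq f x + mvfderiv (𝓡 n) (g.div (g.grad f)) x (g.grad f x)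
          + g.ric x (g.grad f x) (g.grad f x))
      + 2 * ((q - 2) / 2) * (-g.gradSq f x) ^ ((q - 2) / 2 - 1) *
        g.hessForm f x (g.grad f x) (g.hess f x (g.grad f x)) := by
    have hb : g.div (fun y ↦ g.hess f y (g.grad f y)) x = _ := g.div_leviCivita_self hN
    have hsm : DiffAt (fun y ↦ -(-g.gradSq f y) ^ ((q - 2) / 2) • g.hess f y (g.grad f y)) x :=
      hnr.smul_section hV
    rw [g.div_congr hsm hgu, g.div_smul hnr hV, hdnr, hb,
      ← g.trace_hess_comp_hess hf2, hessForm]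
    simp only [hess]
    ring
  have hα : (fun y ↦ g.inner y (g.grad f y) (g.grad (fun y ↦ (-g.gradSq f y) ^ (q / 2) / q) y))
      =ᶠ[𝓝 x] fun y ↦ -(-g.gradSq f y) ^ ((q - 2) / 2) *
        g.hessForm f y (g.grad f y) (g.grad f y) := by
    filter_upwards [hgu] with y hy
    rw [hy, map_smul, smul_eq_mul, hessForm, g.symm y (g.grad f y)]
  have hdα := congrArg (fun A ↦ A (g.grad f x)) (mvfderiv_congr hα)
  rw [mvfderiv_fun_mul hnr hh] at hdα
  simp only [_root_.add_apply, _root_.smul_apply, smul_eq_mul, hdnr] at hdα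
  have hgrad : ∀ v, g.inner x (g.grad (g.qBox q f) x) v = _ := fun v ↦
    (g.inner_grad _ _ _).trans (g.mvfderiv_qBox q hf h0 v)
  rw [qBoxLin, (g.hasDerivAt_qBox q hf2 hu h0).deriv, hdiv, hdα, hα.eq_of_nhds, qGrad, neg_neg,
    map_smul, hgrad, hgu.self_of_nhds]
  simp only [g.mvfderiv_neg_gradSq hf2, map_smul, smul_eq_mul, abs_of_neg h0]
  have hw0 : 0 < -g.gradSq f x := by linarith
  -- all powers in terms of `w ^ p` and integral powers of `w`
  have e1 : (-g.gradSq f x) ^ ((q - 2) / 2 - 1) =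
      (-g.gradSq f x) ^ ((q - 2) / 2) / (-g.gradSq f x) := Real.rpow_sub_one hw0.ne' _
  have e2 : (-g.gradSq f x) ^ ((q - 2) / 2 - 2) =
      (-g.gradSq f x) ^ ((q - 2) / 2) / (-g.gradSq f x) ^ 2 := by
    rw [Real.rpow_sub hw0]; norm_num
  have e3 : (-g.gradSq f x) ^ (q - 2) = ((-g.gradSq f x) ^ ((q - 2) / 2)) ^ 2 := by
    rw [← Real.rpow_natCast, ← Real.rpow_mul hw0.le]; norm_num
  have e4 : (-g.gradSq f x) ^ (q - 3) =
      ((-g.gradSq f x) ^ ((q - 2) / 2)) ^ 2 / (-g.gradSq f x) := by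
    rw [← e3, ← Real.rpow_sub_one hw0.ne']; congr 1; ring
  rw [e1, e2, e3, e4]
  simp only [hessForm]
  generalize (-g.gradSq f x) ^ ((q - 2) / 2) = a
  generalize -g.gradSq f x = w at hw0
  field_simp
  ring

end QBochner

end LorentzianMetric

end

theorem propositionA1 {n : ℕ} (hn : 2 ≤ n) {M : Type*} [TopologicalSpace M] [T2Space M]
    [SecondCountableTopology M] [ChartedSpace (EuclideanSpace ℝ (Fin n)) M]
    [IsManifold (𝓡 n) ∞ M] (g : LorentzianMetric n M) (C : g.TimeOrientation)
    (U : Set M) (hU : IsOpen U) (q : ℝ) (hq : q < 0) (φ : M → ℝ)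
    (hφ : ContMDiffOn (𝓡 n) 𝓘(ℝ) 3 φ U)
    (hfut : ∀ x ∈ U, (⟨x, -g.grad φ x⟩ : TangentBundle (𝓡 n) M) ∈ interior C.cone) :
    -- the linearization `L^q_φ` is well defined on `C²` functions
    (∀ u : M → ℝ, ContMDiffOn (𝓡 n) 𝓘(ℝ) 2 u U → ∀ x ∈ U,
      DifferentiableAt ℝ (fun t : ℝ ↦ g.qBox q (fun y ↦ φ y + t * u y) x) 0) ∧
    -- the function to which it is applied is of class `C²`, and `□^q φ` is of class `C¹`
    ContMDiffOn (𝓡 n) 𝓘(ℝ) 2 (fun y ↦ (-g.gradSq φ y) ^ (q / 2) / q) U ∧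
    ContMDiffOn (𝓡 n) 𝓘(ℝ) 1 (g.qBox q φ) U ∧
    -- the `q`-Bochner identity
    ∀ x ∈ U,
      -g.qBoxLin q φ (fun y ↦ (-g.gradSq φ y) ^ (q / 2) / q) x =
        g.inner x (g.grad (g.qBox q φ) x) (-g.qGrad q φ x)
        + (q - 2) ^ 2 * |g.gradSq φ x| ^ (q - 2) *
            (g.hessForm φ x (g.grad φ x) (g.grad φ x) / |g.gradSq φ x|) ^ 2
        + |g.gradSq φ x| ^ (q - 2) * (g.ric x (g.grad φ x) (g.grad φ x) + g.hessSq φ x)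
        - 2 * (q - 2) * |g.gradSq φ x| ^ (q - 3) *
            g.hessForm φ x (g.grad φ x) (g.hess φ x (g.grad φ x)) := by
  have hφ' : ∀ x ∈ U, ContMDiffAt (𝓡 n) 𝓘(ℝ) 3 φ x := fun x hx ↦
    hφ.contMDiffAt (hU.mem_nhds hx)
  have h0 : ∀ x ∈ U, g.gradSq φ x < 0 := fun x hx ↦ by
    simpa [LorentzianMetric.gradSq] using g.inner_self_neg_of_mem_interior hn C (hfut x hx)
  refine ⟨fun u hu x hx ↦ ?_, fun x hx ↦ ?_, fun x hx ↦ ?_, fun x hx ↦ ?_⟩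
  · exact (g.hasDerivAt_qBox q ((hφ' x hx).of_le (by norm_cast))
      (hu.contMDiffAt (hU.mem_nhds hx)) (h0 x hx)).differentiableAt
  · have h1 := (g.contMDiffAt_gradSq (k := 2) (hφ' x hx)).neg
    exact ((LorentzianMetric.contMDiffAt_rpow (f := fun y ↦ -g.gradSq φ y) h1
      (by linarith [h0 x hx]) (q / 2)).div_const q).contMDiffWithinAt
  · exact (g.contMDiffAt_qBox q (hφ' x hx) (h0 x hx)).contMDiffWithinAt
  · exact g.qBochner hq.ne (hφ' x hx) (h0 x hx)
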